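/- Let $n\ge 1$ and let $B(x,r)$ denote the ball in $\mathbb{R}^n$ with centre $x$ and radius $r$. A Young function is a convex, left-continuous $\Phi:[0,\infty]\to[0,\infty]$ with $\lim_{r\to+0}\Phi(r)=\Phi(0)=0$ and $\lim_{r\to\infty}\Phi(r)=\Phi(\infty)=\infty$; put $\Phi^{-1}(s)=\inf\{r\ge 0:\Phi(r)>s\}$ (with $\inf\emptyset=\infty$). Write $\Phi\in\nabla_2$ if $\Phi(r)\le\frac{1}{2C}\Phi(Cr)$ for all $r\ge 0$, for some $C>1$. Let $\|f\|_{L^\Phi}=\inf\{\lambda>0:\int_{\mathbb{R}^n}\Phi(|f(x)|/\lambda)\,dx\le 1\}$, $\|f\|_{WL^\Phi}=\sup_{\lambda>0}\|\lambda\chi_{(\lambda,\infty)}(|f|)\|_{L^\Phi}$, and, for a ball $B$, $\|f\|_{L^\Phi(B)}=\|f\chi_B\|_{L^\Phi}$, $\|f\|_{WL^\Phi(B)}=\|f\chi_B\|_{WL^\Phi}$. Let $L^\Phi_{\rm loc}$ (resp. $WL^\Phi_{\rm loc}$) be the set of measurable $f$ with $f\chi_B\in L^\Phi$ (resp. $f\chi_B\in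 WL^\Phi$) for every ball $B$. For a positive measurable function $\varphi$ on $(0,\infty)$ let $\mathcal{M}^{\Phi,\varphi}(\mathbb{R}^n)$ be the space of all $f\in L^\Phi_{\rm loc}$ with $$\|f\|_{\mathcal{M}^{\Phi,\varphi}}=\sup_{x\in\mathbb{R}^n,\,r>0}\varphi(r)^{-1}\Phi^{-1}(r^{-n})\|f\|_{L^\Phi(B(x,r))}<\infty,$$ and let $W\mathcal{M}^{\Phi,\varphi}(\mathbb{R}^n)$ be the space of all $f\in WL^\Phi_{\rm loc}$ with $\|f\|_{W\mathcal{M}^{\Phi,\varphi}}<\infty$, where $L^\Phi(B(x,r))$ is replaced by $WL^\Phi(B(x,r))$; for $\Phi(t)=t$ we write $W\mathcal{M}^{1,\varphi}$. A positive function $g$ on $(0,\infty)$ is almost increasing (almost decreasing) if for some $C>0$ one has $g(r)\le Cg(s)$ (resp. $g(r)\ge Cg(s)$) whenever $r\le s$. Let $\mathcal{G}_\Phi$ be the set of positive measurable $\varphi$ on $(0,\infty)$ such that $t\mapsto\varphi(t)/\Phi^{-1}(t^{-n})$ is almost increasing and $t\mapsto\varphi(t)/(\Phi^{-1}(t^{-n})t^n)$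 is almost decreasing. For measurable $\rho:(0,\infty)\to(0,\infty)$ let $$I_\rho f(x)=\int_{\mathbb{R}^n}\frac{\rho(|x-y|)}{|x-y|^n}f(y)\,dy .$$ Boundedness of $I_\rho$ from a space $X$ to a space $Y$ means that there is a constant $C$ such that for every $f\in X$ the integral converges absolutely for almost every $x$, $I_\rho f\in Y$, and $\|I_\rho f\|_Y\le C\|f\|_X$. Consider the conditions, where $C$ denotes a constant independent of $r>0$ and each inequality is required for all $r>0$: (a) $\int_0^1\rho(t)\frac{dt}{t}<\infty$; (b) there are $C>0$ and $0<k_1<k_2$ with $\sup_{r/2\le t\le r}\rho(t)\le C\int_{k_1r}^{k_2r}\rho(t)\frac{dt}{t}$; (c) $\Phi^{-1}(r^{-n})\int_0^r\rho(t)\frac{dt}{t}+\int_r^\infty\rho(t)\Phi^{-1}(t^{-n})\frac{dt}{t}\le C\,\Psi^{-1}(r^{-n})$; (d) $\dfrac{\varphi_1(r)}{\Phi^{-1}(r^{-n})}\le C\,\dfrac{\varphi_2(r)}{\Psi^{-1}(r^{-n})}$; (e) $\int_r^\infty\varphi_1(t)\rho(t)\frac{dt}{t}\le C\,\varphi_2(r)$;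 (f) $\varphi_1(r)\int_0^r\rho(t)\frac{dt}{t}\le C\,\varphi_2(r)$; (g) $\int_r^\infty\varphi_1(t)\rho(t)\frac{dt}{t}\le C\,\varphi_1(r)\rho(r)$. **Theorem (Spanne-type result).** Let $\Phi,\Psi$ be Young functions, $\varphi_1\in\mathcal{G}_\Phi$, $\varphi_2\in\mathcal{G}_\Psi$, and let $\rho:(0,\infty)\to(0,\infty)$ be measurable. 1. Assume (a), (b), (c). If (d) and (e) hold, then $I_\rho$ is bounded from $\mathcal{M}^{\Phi,\varphi_1}(\mathbb{R}^n)$ to $W\mathcal{M}^{\Psi,\varphi_2}(\mathbb{R}^n)$ and to $W\mathcal{M}^{1,\varphi_2}(\mathbb{R}^n)$. If moreover $\Phi\in\nabla_2$, then $I_\rho$ is bounded from $\mathcal{M}^{\Phi,\varphi_1}(\mathbb{R}^n)$ to $\mathcal{M}^{\Psi,\varphi_2}(\mathbb{R}^n)$. 2. Let $\varphi_1$ be almost decreasing. Then (f) is necessary for the boundedness of $I_\rho$ from $\mathcal{M}^{\Phi,\varphi_1}(\mathbb{R}^n)$ to $W\mathcal{M}^{1,\varphi_2}(\mathbb{R}^n)$,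 and likewise for its boundedness from $\mathcal{M}^{\Phi,\varphi_1}(\mathbb{R}^n)$ to $W\mathcal{M}^{\Psi,\varphi_2}(\mathbb{R}^n)$ and to $\mathcal{M}^{\Psi,\varphi_2}(\mathbb{R}^n)$. 3. Assume (a), (b), (c), (d), (g), and that $\varphi_1$ is almost decreasing. Then (f) is necessary and sufficient for the boundedness of $I_\rho$ from $\mathcal{M}^{\Phi,\varphi_1}(\mathbb{R}^n)$ to $W\mathcal{M}^{\Psi,\varphi_2}(\mathbb{R}^n)$. If moreover $\Phi\in\nabla_2$, then (f) is necessary and sufficient for the boundedness of $I_\rho$ from $\mathcal{M}^{\Phi,\varphi_1}(\mathbb{R}^n)$ to $\mathcal{M}^{\Psi,\varphi_2}(\mathbb{R}^n)$. -/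

import Mathlib

open MeasureTheory Set Filter Topology
open scoped ENNReal NNReal

namespace OrliczMorrey

noncomputable section

/-- The Euclidean space `ℝⁿ`. -/
abbrev E (n : ℕ) : Type := EuclideanSpace ℝ (Fin n)

/-! ### Young functions -/

/-- Young functions `Φ : [0,∞] → [0,∞]`: convex, left-continuous,
`lim_{r → 0+} Φ r = Φ 0 = 0` and `lim_{r → ∞} Φ r = Φ ∞ = ∞`. -/
structure IsYoung (Φ : ℝ≥0∞ → ℝ≥0∞) : Prop where
  convex : ConvexOn ℝ≥0 univ Φ
  left_cont : ∀ r, ContinuousWithinAt Φ (Iic r) r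
  map_zero : Φ 0 = 0
  tendsto_zero : Tendsto Φ (𝓝[>] 0) (𝓝 0)
  map_top : Φ ⊤ = ⊤
  tendsto_top : Tendsto Φ (𝓝[<] ⊤) (𝓝 ⊤)

/-- The generalized inverse `Φ⁻¹(s) = inf {r ≥ 0 : Φ(r) > s}`, with `inf ∅ = ∞`. -/
def youngInv (Φ : ℝ≥0∞ → ℝ≥0∞) (s : ℝ≥0∞) : ℝ≥0∞ := sInf {r | s < Φ r}

/-- The quantity `Φ⁻¹(r⁻ⁿ)` for `r > 0`. -/
def invPow (n : ℕ) (Φ : ℝ≥0∞ → ℝ≥0∞) (r : ℝ) : ℝ≥0∞ := youngInv Φ (ENNReal.ofReal ((r ^ n)⁻¹))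

/-- The `∇₂`-condition: `Φ(r) ≤ Φ(C r) / (2 C)` for all `r ≥ 0`, for some `C > 1`. -/
def Nabla2 (Φ : ℝ≥0∞ → ℝ≥0∞) : Prop :=
  ∃ C : ℝ≥0, 1 < C ∧ ∀ r : ℝ≥0∞, Φ r ≤ Φ (C * r) / (2 * C)

/-! ### Orlicz and weak Orlicz spaces -/

/-- The Luxemburg functional `inf {λ > 0 : ∫ Φ(g(x)/λ) dx ≤ 1}` of a function `g ≥ 0`,
with value `∞` if there is no such real `λ`. -/
def luxNorm {n : ℕ} (Φ : ℝ≥0∞ → ℝ≥0∞) (g : E n → ℝ≥0∞) : ℝ≥0∞ :=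
  sInf {l : ℝ≥0∞ | 0 < l ∧ l < ⊤ ∧ (∫⁻ x, Φ (g x / l)) ≤ 1}

variable {𝕜 : Type*} [RCLike 𝕜] {n : ℕ}

/-- The norm of `L^Φ(ℝⁿ)`. -/
def orliczNorm (Φ : ℝ≥0∞ → ℝ≥0∞) (f : E n → 𝕜) : ℝ≥0∞ := luxNorm Φ (fun x => ‖f x‖ₑ)

/-- The quasi-norm `sup_{λ > 0} ‖λ χ_{(λ,∞)}(|f|)‖_{L^Φ}` of the weak space `WL^Φ(ℝⁿ)`. -/
def weakOrliczNorm (Φ : ℝ≥0∞ → ℝ≥0∞) (f : E n → 𝕜) : ℝ≥0∞ :=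
  ⨆ (l : ℝ≥0) (_ : 0 < l), luxNorm Φ ({x | (l : ℝ≥0∞) < ‖f x‖ₑ}.indicator fun _ => (l : ℝ≥0∞))

/-- `f ∈ L^Φ(ℝⁿ)`. -/
def MemOrlicz (Φ : ℝ≥0∞ → ℝ≥0∞) (f : E n → 𝕜) : Prop :=
  LocallyIntegrable f ∧ ∃ k : ℝ≥0, 0 < k ∧ (∫⁻ x, Φ (k * ‖f x‖ₑ)) < ⊤

/-- `f ∈ L^Φ_loc(ℝⁿ)`: `f` is measurable and `f χ_B ∈ L^Φ(ℝⁿ)` for all balls `B`. -/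
def MemOrliczLoc (Φ : ℝ≥0∞ → ℝ≥0∞) (f : E n → 𝕜) : Prop :=
  AEStronglyMeasurable f ∧
    ∀ (x : E n) (r : ℝ), 0 < r → MemOrlicz Φ ((Metric.ball x r).indicator f)

/-- `f ∈ WL^Φ_loc(ℝⁿ)`: `f` is measurable and `f χ_B ∈ WL^Φ(ℝⁿ)` for all balls `B`. -/
def MemWeakOrliczLoc (Φ : ℝ≥0∞ → ℝ≥0∞) (f : E n → 𝕜) : Prop :=
  AEStronglyMeasurable f ∧
    ∀ (x : E n) (r : ℝ), 0 < r → weakOrliczNorm Φ ((Metric.ball x r).indicator f) < ⊤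

/-! ### Generalized Orlicz--Morrey spaces of the third kind

Functions on `(0,∞)` are represented by functions on `ℝ`, of which only the values at positive
arguments are used. -/

/-- The norm `sup_{x, r > 0} φ(r)⁻¹ Φ⁻¹(r⁻ⁿ) ‖f‖_{L^Φ(B(x,r))}`. -/
def morreyNorm (Φ : ℝ≥0∞ → ℝ≥0∞) (φ : ℝ → ℝ) (f : E n → 𝕜) : ℝ≥0∞ :=
  ⨆ (x : E n) (r : ℝ) (_ : 0 < r),
    (ENNReal.ofReal (φ r))⁻¹ * invPow n Φ r * orliczNorm Φ ((Metric.ball x r).indicator f)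

/-- The quasi-norm `sup_{x, r > 0} φ(r)⁻¹ Φ⁻¹(r⁻ⁿ) ‖f‖_{WL^Φ(B(x,r))}`. -/
def weakMorreyNorm (Φ : ℝ≥0∞ → ℝ≥0∞) (φ : ℝ → ℝ) (f : E n → 𝕜) : ℝ≥0∞ :=
  ⨆ (x : E n) (r : ℝ) (_ : 0 < r),
    (ENNReal.ofReal (φ r))⁻¹ * invPow n Φ r * weakOrliczNorm Φ ((Metric.ball x r).indicator f)

/-- Membership in the generalized Orlicz--Morrey space `𝓜^{Φ,φ}(ℝⁿ)`. -/
def MemMorrey (Φ : ℝ≥0∞ → ℝ≥0∞) (φ : ℝ → ℝ) (f : E n → 𝕜) : Prop :=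
  MemOrliczLoc Φ f ∧ morreyNorm Φ φ f < ⊤

/-- Membership in the weak generalized Orlicz--Morrey space `W𝓜^{Φ,φ}(ℝⁿ)`. -/
def MemWeakMorrey (Φ : ℝ≥0∞ → ℝ≥0∞) (φ : ℝ → ℝ) (f : E n → 𝕜) : Prop :=
  MemWeakOrliczLoc Φ f ∧ weakMorreyNorm Φ φ f < ⊤

/-- A positive Lebesgue measurable function on `(0,∞)`. -/
def PosMeas (φ : ℝ → ℝ) : Prop :=
  AEMeasurable φ (volume.restrict (Ioi 0)) ∧ ∀ t, 0 < t → 0 < φ t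

/-- `g` is almost increasing on `(0,∞)`: `g(r) ≤ C g(s)` for `r ≤ s`. -/
def AlmostIncreasing (g : ℝ → ℝ≥0∞) : Prop :=
  ∃ C : ℝ≥0, 0 < C ∧ ∀ r s : ℝ, 0 < r → r ≤ s → g r ≤ C * g s

/-- `g` is almost decreasing on `(0,∞)`: `g(r) ≥ C g(s)` for `r ≤ s`. -/
def AlmostDecreasing (g : ℝ → ℝ≥0∞) : Prop :=
  ∃ C : ℝ≥0, 0 < C ∧ ∀ r s : ℝ, 0 < r → r ≤ s → C * g s ≤ g r

/-- The class `𝓖_Φ` of positive measurable `φ` on `(0,∞)` for which `φ(t) / Φ⁻¹(t⁻ⁿ)` is almost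
increasing and `φ(t) / (Φ⁻¹(t⁻ⁿ) tⁿ)` is almost decreasing. -/
def ClassG (n : ℕ) (Φ : ℝ≥0∞ → ℝ≥0∞) (φ : ℝ → ℝ) : Prop :=
  PosMeas φ ∧
    AlmostIncreasing (fun t => ENNReal.ofReal (φ t) / invPow n Φ t) ∧
    AlmostDecreasing (fun t => ENNReal.ofReal (φ t) / (invPow n Φ t * ENNReal.ofReal (t ^ n)))

/-! ### The generalized fractional integral operator -/

/-- The generalized fractional integral `I_ρ f(x) = ∫ ρ(|x-y|) / |x-y|ⁿ f(y) dy`. -/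
def fracInt (ρ : ℝ → ℝ) (f : E n → 𝕜) (x : E n) : 𝕜 :=
  ∫ y, (ρ ‖x - y‖ / ‖x - y‖ ^ n) • f y

/-- The integral defining `I_ρ f(x)` converges absolutely for almost every `x`. -/
def FracIntDefined (ρ : ℝ → ℝ) (f : E n → 𝕜) : Prop :=
  ∀ᵐ x : E n, Integrable (fun y : E n => (ρ ‖x - y‖ / ‖x - y‖ ^ n) • f y)

variable (𝕜 n)

/-- `I_ρ` is bounded from `𝓜^{Φ,φ₁}(ℝⁿ)` to `𝓜^{Ψ,φ₂}(ℝⁿ)` (functions with values in `𝕜`). -/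
def BoundedStrong (ρ : ℝ → ℝ) (Φ : ℝ≥0∞ → ℝ≥0∞) (φ₁ : ℝ → ℝ) (Ψ : ℝ≥0∞ → ℝ≥0∞) (φ₂ : ℝ → ℝ) :
    Prop :=
  ∃ C : ℝ≥0, ∀ f : E n → 𝕜, MemMorrey Φ φ₁ f →
    FracIntDefined ρ f ∧ MemMorrey Ψ φ₂ (fracInt ρ f) ∧
      morreyNorm Ψ φ₂ (fracInt ρ f) ≤ C * morreyNorm Φ φ₁ f

/-- `I_ρ` is bounded from `𝓜^{Φ,φ₁}(ℝⁿ)` to `W𝓜^{Ψ,φ₂}(ℝⁿ)` (functions with values in `𝕜`). -/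
def BoundedWeak (ρ : ℝ → ℝ) (Φ : ℝ≥0∞ → ℝ≥0∞) (φ₁ : ℝ → ℝ) (Ψ : ℝ≥0∞ → ℝ≥0∞) (φ₂ : ℝ → ℝ) :
    Prop :=
  ∃ C : ℝ≥0, ∀ f : E n → 𝕜, MemMorrey Φ φ₁ f →
    FracIntDefined ρ f ∧ MemWeakMorrey Ψ φ₂ (fracInt ρ f) ∧
      weakMorreyNorm Ψ φ₂ (fracInt ρ f) ≤ C * morreyNorm Φ φ₁ f

/-! ### The conditions on `ρ`, `Φ`, `Ψ`, `φ₁`, `φ₂` -/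

/-- `∫₀¹ ρ(t) dt/t < ∞`. -/
def IntCond (ρ : ℝ → ℝ) : Prop := (∫⁻ t in Ioo 0 1, ENNReal.ofReal (ρ t / t)) < ⊤

/-- `sup_{r/2 ≤ t ≤ r} ρ(t) ≤ C ∫_{k₁ r}^{k₂ r} ρ(t) dt/t` for all `r > 0`, with `0 < k₁ < k₂`. -/
def SupCond (ρ : ℝ → ℝ) : Prop :=
  ∃ (C : ℝ≥0) (k₁ k₂ : ℝ), 0 < C ∧ 0 < k₁ ∧ k₁ < k₂ ∧ ∀ r : ℝ, 0 < r →
    (⨆ t ∈ Icc (r / 2) r, ENNReal.ofReal (ρ t)) ≤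
      C * (∫⁻ t in Ioo (k₁ * r) (k₂ * r), ENNReal.ofReal (ρ t / t))

/-- `Φ⁻¹(r⁻ⁿ) ∫₀^r ρ(t) dt/t + ∫_r^∞ ρ(t) Φ⁻¹(t⁻ⁿ) dt/t ≤ C Ψ⁻¹(r⁻ⁿ)` for all `r > 0`. -/
def OrliczCond (ρ : ℝ → ℝ) (Φ Ψ : ℝ≥0∞ → ℝ≥0∞) : Prop :=
  ∃ C : ℝ≥0, ∀ r : ℝ, 0 < r →
    invPow n Φ r * (∫⁻ t in Ioo 0 r, ENNReal.ofReal (ρ t / t)) +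
      (∫⁻ t in Ioi r, ENNReal.ofReal (ρ t / t) * invPow n Φ t) ≤ C * invPow n Ψ r

/-- `φ₁(r) / Φ⁻¹(r⁻ⁿ) ≤ C φ₂(r) / Ψ⁻¹(r⁻ⁿ)` for all `r > 0`. -/
def RatioCond (Φ Ψ : ℝ≥0∞ → ℝ≥0∞) (φ₁ φ₂ : ℝ → ℝ) : Prop :=
  ∃ C : ℝ≥0, ∀ r : ℝ, 0 < r →
    ENNReal.ofReal (φ₁ r) / invPow n Φ r ≤ C * (ENNReal.ofReal (φ₂ r) / invPow n Ψ r)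

/-- `∫_r^∞ φ₁(t) ρ(t) dt/t ≤ C φ₂(r)` for all `r > 0`. -/
def TailCond (ρ φ₁ φ₂ : ℝ → ℝ) : Prop :=
  ∃ C : ℝ≥0, ∀ r : ℝ, 0 < r →
    (∫⁻ t in Ioi r, ENNReal.ofReal (φ₁ t * ρ t / t)) ≤ C * ENNReal.ofReal (φ₂ r)

/-- `φ₁(r) ∫₀^r ρ(t) dt/t ≤ C φ₂(r)` for all `r > 0`. -/
def SpanneCond (ρ φ₁ φ₂ : ℝ → ℝ) : Prop :=
  ∃ C : ℝ≥0, ∀ r : ℝ, 0 < r →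
    ENNReal.ofReal (φ₁ r) * (∫⁻ t in Ioo 0 r, ENNReal.ofReal (ρ t / t)) ≤
      C * ENNReal.ofReal (φ₂ r)

end

end OrliczMorrey

open OrliczMorrey

/-! Sufficiency. Fix a ball B(x₀,r) and cut |f| at B(x₀,2r). Jensen's inequality gives ∫_{B(x,R)}
|f| ≲ Rⁿ φ₁(R) ‖f‖, so for x in B(x₀,r) a sum of the kernel over dyadic annuli bounds the far part
pointwise by a multiple of ∫_{kr}^∞ φ₁ρ dt/t, hence by φ₂(r) through `TailCond` and doubling. The
local part has L^Φ norm ≲ φ₁(2r)/Φ⁻¹((2r)⁻ⁿ) ≲ φ₂(r)/Ψ⁻¹(r⁻ⁿ) by `RatioCond`, and is carried to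
(weak) L^Ψ by the Orlicz theory of I_ρ.

That theory rests on Hedberg's inequality `exists_map_potential_le`: if ∫Φ(g) ≤ 1, then Ψ(I_ρ
g(x)/C) ≤ Φ(Mg(x)), with M the maximal operator. Given s > Φ(Mg(x)), choose r with r⁻ⁿ = s: near x
the averages of g are at most Mg(x) ≤ Φ⁻¹(r⁻ⁿ), far from x Jensen bounds them by Φ⁻¹(R⁻ⁿ), and
`OrliczCond` is exactly what bounds the two resulting integrals by Ψ⁻¹(r⁻ⁿ). The weak bound follows
from Φ(M(g/2)) ≤ M(Φ∘g) and the weak (1,1) inequality; under ∇₂ the modular bound for M gives the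
strong one.

Necessity. The function χ_{B(0,2s)} has Morrey norm ≲ 1/φ₁(2s), and on B(0,s) its fractional
integral is at least a constant times ∫₀ˢ ρ dt/t. Testing in W𝓜^{1,φ₂}, the largest of the three
targets, gives `SpanneCond`.

Characterization. The tail assumption, `SupCond` and doubling turn `SpanneCond` back into
`TailCond`, so the first two parts meet. -/

namespace OrliczMorrey

/-! ### Young functions and their generalized inverses -/

namespace IsYoung

variable {Φ : ℝ≥0∞ → ℝ≥0∞}

theorem map_mul_le (h : IsYoung Φ) {a : ℝ≥0} (ha : a ≤ 1) (x : ℝ≥0∞) :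
    Φ (a * x) ≤ a * Φ x := by
  have := h.convex.2 (mem_univ x) (mem_univ 0) (zero_le (a := a)) (zero_le (a := 1 - a))
    (add_tsub_cancel_of_le ha)
  simpa [h.map_zero, ENNReal.smul_def] using this

theorem map_half_add_half (h : IsYoung Φ) (x y : ℝ≥0∞) :
    Φ (x / 2 + y / 2) ≤ Φ x / 2 + Φ y / 2 := by
  have := h.convex.2 (mem_univ x) (mem_univ y) (zero_le (a := (2⁻¹ : ℝ≥0)))
    (zero_le (a := (2⁻¹ : ℝ≥0))) (by rw [← two_mul]; simp)
  simpa [ENNReal.smul_def, ENNReal.div_eq_inv_mul] using this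

theorem mono (h : IsYoung Φ) : Monotone Φ := by
  intro x y hxy
  rcases eq_or_ne y ⊤ with rfl | hy
  · simp [h.map_top]
  rcases eq_or_ne y 0 with rfl | hy0
  · simp [le_antisymm hxy zero_le]
  have hxy' : x / y ≤ 1 := ENNReal.div_le_of_le_mul (by simpa using hxy)
  have hne : x / y ≠ ⊤ := ne_top_of_le_ne_top ENNReal.one_ne_top hxy'
  have h1 := h.map_mul_le (a := (x / y).toNNReal)
    (by rw [← ENNReal.coe_le_coe, ENNReal.coe_toNNReal hne]; simpa using hxy') y
  rw [ENNReal.coe_toNNReal hne, ENNReal.div_mul_cancel hy0 hy] at h1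
  exact h1.trans (mul_le_of_le_one_left' hxy')

theorem le_youngInv (h : IsYoung Φ) {u s : ℝ≥0∞} (hu : Φ u ≤ s) : u ≤ youngInv Φ s := by
  refine le_sInf fun r hr => ?_
  by_contra! hlt
  exact absurd (h.mono hlt.le) (not_le.2 (hu.trans_lt hr))

/-- This is where left continuity enters: Φ ≤ s strictly below the infimum, and the bound passes to
the limit from the left. -/
theorem map_youngInv_le (h : IsYoung Φ) (s : ℝ≥0∞) : Φ (youngInv Φ s) ≤ s := by
  rcases eq_or_ne (youngInv Φ s) 0 with h0 | h0
  · simp [h0, h.map_zero]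
  have hc : Tendsto Φ (𝓝[<] (youngInv Φ s)) (𝓝 (Φ (youngInv Φ s))) :=
    (h.left_cont _).mono_left (nhdsWithin_mono _ Iio_subset_Iic_self)
  have : (𝓝[<] (youngInv Φ s)).NeBot := nhdsLT_neBot_of_exists_lt ⟨0, pos_iff_ne_zero.2 h0⟩
  refine le_of_tendsto hc (eventually_nhdsWithin_of_forall fun u hu => ?_)
  by_contra! hlt
  exact absurd (sInf_le (show u ∈ {r | s < Φ r} from hlt)) (not_le.2 hu)

/-- The Galois connection through which modular inequalities and bounds by the inverse are exchanged
in all later estimates. -/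
theorem le_youngInv_iff (h : IsYoung Φ) {u s : ℝ≥0∞} : u ≤ youngInv Φ s ↔ Φ u ≤ s :=
  ⟨fun hu => (h.mono hu).trans (h.map_youngInv_le s), h.le_youngInv⟩

theorem youngInv_mono (h : IsYoung Φ) : Monotone (youngInv Φ) := fun _ _ hst =>
  h.le_youngInv ((h.map_youngInv_le _).trans hst)

theorem youngInv_mul_le (h : IsYoung Φ) {c : ℝ≥0} (hc : 1 ≤ c) (s : ℝ≥0∞) :
    youngInv Φ (c * s) ≤ c * youngInv Φ s := by
  have hc0 : (c : ℝ≥0∞) ≠ 0 := by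
    simpa using (zero_lt_one.trans_le hc).ne'
  have hc0' : c ≠ 0 := (zero_lt_one.trans_le hc).ne'
  have h1 : Φ ((c⁻¹ : ℝ≥0) * youngInv Φ (c * s)) ≤ s := by
    refine (h.map_mul_le (inv_le_one_of_one_le₀ hc) _).trans ?_
    refine (mul_le_mul_right (h.map_youngInv_le _) _).trans ?_
    rw [← mul_assoc, ← ENNReal.coe_mul, inv_mul_cancel₀ hc0', ENNReal.coe_one, one_mul]
  have h2 := mul_le_mul_right (h.le_youngInv h1) (c : ℝ≥0∞)
  rwa [← mul_assoc, ← ENNReal.coe_mul, mul_inv_cancel₀ hc0', ENNReal.coe_one, one_mul] at h2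

theorem youngInv_pos (h : IsYoung Φ) {s : ℝ≥0∞} (hs : 0 < s) : 0 < youngInv Φ s := by
  have h1 : ∀ᶠ u in 𝓝[>] (0 : ℝ≥0∞), Φ u < s := h.tendsto_zero.eventually_lt_const hs
  have : (𝓝[>] (0 : ℝ≥0∞)).NeBot := nhdsGT_neBot_of_exists_gt ⟨1, zero_lt_one⟩
  obtain ⟨u, hu, hu0⟩ := (h1.and self_mem_nhdsWithin).exists
  exact lt_of_lt_of_le hu0 (h.le_youngInv hu.le)

theorem exists_lt_map (h : IsYoung Φ) {s : ℝ≥0∞} (hs : s < ⊤) : ∃ u < ⊤, s < Φ u := by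
  have h1 : ∀ᶠ u in 𝓝[<] (⊤ : ℝ≥0∞), s < Φ u := h.tendsto_top.eventually_const_lt hs
  have : (𝓝[<] (⊤ : ℝ≥0∞)).NeBot := nhdsLT_neBot_of_exists_lt ⟨1, ENNReal.one_lt_top⟩
  obtain ⟨u, hu, hu0⟩ := (h1.and self_mem_nhdsWithin).exists
  exact ⟨u, hu0, hu⟩

theorem youngInv_lt_top (h : IsYoung Φ) {s : ℝ≥0∞} (hs : s < ⊤) : youngInv Φ s < ⊤ := by
  obtain ⟨u, hu, hsu⟩ := h.exists_lt_map hs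
  exact (sInf_le (show u ∈ {r | s < Φ r} from hsu)).trans_lt hu

/-- Convexity and Φ(0) = 0 make Φ(v)/v increasing, so for v ≥ u one has Φ(v)/v ≥ w/u; for v ≤ u the
first summand suffices. It replaces the supporting line in Jensen's inequality and needs no
derivative of Φ. -/
theorem le_add_mul (h : IsYoung Φ) {u w : ℝ≥0∞} (hw : w ≤ Φ u) (hw0 : 0 < w) (hwt : w < ⊤)
    (hu : u < ⊤) (v : ℝ≥0∞) : v ≤ u + u / w * Φ v := by
  have hu0 : u ≠ 0 := by
    rintro rfl
    rw [h.map_zero] at hw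
    exact absurd hw0 (not_lt.2 hw)
  rcases le_total v u with hvu | huv
  · exact hvu.trans le_self_add
  refine le_trans ?_ le_add_self
  rcases eq_or_ne v ⊤ with rfl | hv
  · rw [h.map_top, ENNReal.mul_top (ENNReal.div_pos hu0 hwt.ne).ne']
  have hv0 : v ≠ 0 := fun h0 => hu0 (le_antisymm (h0 ▸ huv) zero_le)
  have huv1 : u / v ≤ 1 := ENNReal.div_le_of_le_mul (by simpa using huv)
  have hne : u / v ≠ ⊤ := ne_top_of_le_ne_top ENNReal.one_ne_top huv1
  have h1 := h.map_mul_le (a := (u / v).toNNReal)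
    (by rw [← ENNReal.coe_le_coe, ENNReal.coe_toNNReal hne]; simpa using huv1) v
  rw [ENNReal.coe_toNNReal hne, ENNReal.div_mul_cancel hv0 hv] at h1
  calc v = v / w * w := (ENNReal.div_mul_cancel hw0.ne' hwt.ne).symm
    _ ≤ v / w * (u / v * Φ v) := mul_le_mul_right (hw.trans h1) _
    _ = u / w * Φ v * (v / v) := by simp only [ENNReal.div_eq_inv_mul]; ring
    _ = u / w * Φ v := by rw [ENNReal.div_self hv0 hv, mul_one]

/-- A form of Jensen's inequality, with a loss of a factor `2`. -/
theorem lintegral_le_youngInv (h : IsYoung Φ) {α : Type*} [MeasurableSpace α] {μ : Measure α}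
    [IsFiniteMeasure μ] {s : ℝ≥0∞} (hs0 : 0 < s) (hs : s < ⊤) {g : α → ℝ≥0∞}
    (hg : ∫⁻ x, Φ (g x) ∂μ ≤ s * μ univ) :
    ∫⁻ x, g x ∂μ ≤ 2 * youngInv Φ s * μ univ := by
  -- Each of the two terms of the linear bound contributes u · μ(univ), hence the factor 2. The
  -- infimum over all u with Φ(u) > s then gives the inverse at s.
  have key : ∀ u, s < Φ u → ∫⁻ x, g x ∂μ ≤ 2 * μ univ * u := by
    intro u hu
    rcases eq_or_ne (μ univ) 0 with h0 | h0
    · rw [Measure.measure_univ_eq_zero.1 h0]; simp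
    rcases eq_or_ne u ⊤ with rfl | hut
    · rw [ENNReal.mul_top (by simp [h0])]; exact le_top
    calc ∫⁻ x, g x ∂μ ≤ ∫⁻ x, u + u / s * Φ (g x) ∂μ :=
          lintegral_mono fun x => h.le_add_mul hu.le hs0 hs (lt_top_iff_ne_top.2 hut) _
      _ = u * μ univ + u / s * ∫⁻ x, Φ (g x) ∂μ := by
          rw [lintegral_add_left measurable_const, lintegral_const,
            lintegral_const_mul' _ _ (ENNReal.div_lt_top hut hs0.ne').ne]
      _ ≤ u * μ univ + u / s * (s * μ univ) := by gcongr
      _ = 2 * μ univ * u := by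
          rw [← mul_assoc, ENNReal.div_mul_cancel hs0.ne' hs.ne]; ring
  rcases eq_or_ne (μ univ) 0 with h0 | h0
  · rw [Measure.measure_univ_eq_zero.1 h0]; simp
  have h2 : (2 * μ univ) ≠ 0 := by simp [h0]
  have h3 : (2 * μ univ) ≠ ⊤ := ENNReal.mul_ne_top (by simp) (measure_ne_top _ _)
  have : (∫⁻ x, g x ∂μ) / (2 * μ univ) ≤ youngInv Φ s :=
    le_sInf fun u hu => ENNReal.div_le_of_le_mul ((key u hu).trans_eq (mul_comm _ _))
  rw [ENNReal.div_le_iff_le_mul (Or.inl h2) (Or.inl h3)] at this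
  exact this.trans_eq (by ring)

theorem id : IsYoung (fun t => t) where
  convex := convexOn_id convex_univ
  left_cont := fun _ => continuousWithinAt_id
  map_zero := rfl
  tendsto_zero := tendsto_id.mono_left nhdsWithin_le_nhds
  map_top := rfl
  tendsto_top := tendsto_id.mono_left nhdsWithin_le_nhds

end IsYoung

/-- A positive function whose values at comparable arguments are comparable. -/
def IsDoubling (F : ℝ → ℝ≥0∞) : Prop :=
  ∀ a b : ℝ, 0 < a → 0 < b → ∃ A : ℝ≥0, 0 < A ∧ ∀ R t : ℝ, 0 < R → 0 < t → a * R ≤ t → t ≤ b * R →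
    F R ≤ A * F t

/-! ### Doubling of Φ⁻¹(r⁻ⁿ) and of functions in the class 𝓖_Φ -/

section InvPow

variable {n : ℕ} {Φ : ℝ≥0∞ → ℝ≥0∞}

theorem invPow_pos (h : IsYoung Φ) {r : ℝ} (hr : 0 < r) : 0 < invPow n Φ r :=
  h.youngInv_pos (ENNReal.ofReal_pos.2 (by positivity))

theorem invPow_lt_top (h : IsYoung Φ) (r : ℝ) : invPow n Φ r < ⊤ :=
  h.youngInv_lt_top ENNReal.ofReal_lt_top

theorem invPow_anti (h : IsYoung Φ) {r t : ℝ} (hr : 0 < r) (hrt : r ≤ t) :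
    invPow n Φ t ≤ invPow n Φ r :=
  h.youngInv_mono (ENNReal.ofReal_le_ofReal (by gcongr))

theorem youngInv_mul_le' (h : IsYoung Φ) (c : ℝ≥0) (s : ℝ≥0∞) :
    youngInv Φ (c * s) ≤ (max 1 c : ℝ≥0) * youngInv Φ s := by
  refine (h.youngInv_mono ?_).trans (h.youngInv_mul_le (le_max_left 1 c) s)
  gcongr
  exact le_max_right _ _

/-- Equivalently, rⁿ Φ⁻¹(r⁻ⁿ) is increasing: this is Φ⁻¹(cs) ≤ c Φ⁻¹(s) for c = (t/r)ⁿ ≥ 1. -/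
theorem invPow_le_mul (h : IsYoung Φ) {r t : ℝ} (hr : 0 < r) (hrt : r ≤ t) :
    invPow n Φ r ≤ ENNReal.ofReal ((t / r) ^ n) * invPow n Φ t := by
  have ht : 0 < t := hr.trans_le hrt
  have h1 : (1 : ℝ≥0) ≤ ((t / r) ^ n).toNNReal := by
    rw [← Real.toNNReal_one]
    exact Real.toNNReal_le_toNNReal (one_le_pow₀ ((one_le_div hr).2 hrt))
  have h2 := h.youngInv_mul_le h1 (ENNReal.ofReal ((t ^ n)⁻¹))
  have h3 : ENNReal.ofReal ((t / r) ^ n) * ENNReal.ofReal ((t ^ n)⁻¹)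
      = ENNReal.ofReal ((r ^ n)⁻¹) := by
    rw [← ENNReal.ofReal_mul (by positivity)]
    congr 1
    rw [div_pow]
    field_simp
  rw [show ((((t / r) ^ n).toNNReal : ℝ≥0) : ℝ≥0∞) = ENNReal.ofReal ((t / r) ^ n) from rfl, h3] at h2
  exact h2

theorem isDoubling_invPow (h : IsYoung Φ) : IsDoubling (invPow n Φ) := by
  intro a b ha hb
  refine ⟨max 1 (b ^ n).toNNReal, by positivity, fun R t hR ht hat htb => ?_⟩
  rcases le_total t R with htR | hRt
  · refine (invPow_anti h ht htR).trans (le_mul_of_one_le_left' ?_)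
    exact_mod_cast le_max_left _ _
  · refine (invPow_le_mul h hR hRt).trans ?_
    gcongr
    refine le_trans (ENNReal.ofReal_le_ofReal (q := b ^ n) ?_) ?_
    · have : t / R ≤ b := (div_le_iff₀ hR).2 htb
      gcongr
    · exact ENNReal.coe_le_coe.2 (le_max_right _ _)

theorem ClassG.pos {φ : ℝ → ℝ} (hφ : ClassG n Φ φ) {r : ℝ} (hr : 0 < r) :
    0 < ENNReal.ofReal (φ r) := ENNReal.ofReal_pos.2 (hφ.1.2 r hr)

/-- Almost monotonicity of the quotient handles R ≤ t. For t ≤ R the second condition of 𝓖_Φ loses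
only (R/t)ⁿ ≤ a⁻ⁿ. -/
theorem ClassG.isDoubling_div {φ : ℝ → ℝ} (hφ : ClassG n Φ φ) :
    IsDoubling (fun t => ENNReal.ofReal (φ t) / invPow n Φ t) := by
  obtain ⟨-, ⟨C₁, hC₁, h₁⟩, C₂, hC₂, h₂⟩ := hφ
  intro a b ha hb
  refine ⟨max C₁ (C₂⁻¹ * (a⁻¹ ^ n).toNNReal), by positivity, fun R t hR ht hat htb => ?_⟩
  rcases le_total R t with hRt | htR
  · refine (h₁ R t hR hRt).trans ?_
    gcongr
    exact le_max_left _ _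
  · have h3 := h₂ t R ht htR
    have hR0 : ENNReal.ofReal (R ^ n) ≠ 0 := (ENNReal.ofReal_pos.2 (by positivity)).ne'
    have ht0 : ENNReal.ofReal (t ^ n) ≠ 0 := (ENNReal.ofReal_pos.2 (by positivity)).ne'
    have e1 : ∀ s : ℝ, 0 < s → ENNReal.ofReal (φ s) / invPow n Φ s =
        ENNReal.ofReal (s ^ n) *
          (ENNReal.ofReal (φ s) / (invPow n Φ s * ENNReal.ofReal (s ^ n))) := by
      intro s hs
      have hs0 : ENNReal.ofReal (s ^ n) ≠ 0 := (ENNReal.ofReal_pos.2 (by positivity)).ne'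
      rw [mul_comm (ENNReal.ofReal (s ^ n)), ← ENNReal.mul_div_right_comm,
        ENNReal.mul_div_mul_right _ _ hs0 ENNReal.ofReal_ne_top]
    have hC : (C₂ : ℝ≥0∞) ≠ 0 := by simpa using hC₂.ne'
    calc ENNReal.ofReal (φ R) / invPow n Φ R = ENNReal.ofReal (R ^ n) *
          (ENNReal.ofReal (φ R) / (invPow n Φ R * ENNReal.ofReal (R ^ n))) := e1 R hR
      _ ≤ (ENNReal.ofReal (a⁻¹ ^ n) * ENNReal.ofReal (t ^ n)) * ((C₂⁻¹ : ℝ≥0) *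
          (ENNReal.ofReal (φ t) / (invPow n Φ t * ENNReal.ofReal (t ^ n)))) := by
          refine mul_le_mul' ?_ ?_
          · rw [← ENNReal.ofReal_mul (by positivity), ← mul_pow]
            refine ENNReal.ofReal_le_ofReal (pow_le_pow_left₀ hR.le ?_ n)
            rw [inv_mul_eq_div, le_div_iff₀ ha]
            linarith
          · rw [ENNReal.coe_inv hC₂.ne', ← ENNReal.div_eq_inv_mul]
            rwa [ENNReal.le_div_iff_mul_le (Or.inl hC) (Or.inl ENNReal.coe_ne_top), mul_comm]
      _ = ((C₂⁻¹ : ℝ≥0) * ENNReal.ofReal (a⁻¹ ^ n)) * (ENNReal.ofReal (φ t) / invPow n Φ t) := by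
          rw [e1 t ht]; ring
      _ ≤ _ := by
          gcongr
          rw [ENNReal.ofReal, ← ENNReal.coe_mul]
          exact ENNReal.coe_le_coe.2 (le_max_right _ _)

theorem IsDoubling.mul {F G : ℝ → ℝ≥0∞} (hF : IsDoubling F) (hG : IsDoubling G) :
    IsDoubling (fun t => F t * G t) := by
  intro a b ha hb
  obtain ⟨A, hA, h1⟩ := hF a b ha hb
  obtain ⟨B, hB, h2⟩ := hG a b ha hb
  refine ⟨A * B, by positivity, fun R t hR ht hat htb => ?_⟩
  refine (mul_le_mul' (h1 R t hR ht hat htb) (h2 R t hR ht hat htb)).trans_eq ?_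
  push_cast
  ring

theorem IsDoubling.const_mul {F : ℝ → ℝ≥0∞} (hF : IsDoubling F) (c : ℝ≥0∞) :
    IsDoubling (fun t => c * F t) := by
  refine IsDoubling.mul (fun a b _ _ => ⟨1, one_pos, fun R t _ _ _ _ => ?_⟩) hF
  simp

theorem ClassG.isDoubling (h : IsYoung Φ) {φ : ℝ → ℝ} (hφ : ClassG n Φ φ) :
    IsDoubling (fun t => ENNReal.ofReal (φ t)) := by
  have h1 := (hφ.isDoubling_div).mul (isDoubling_invPow (n := n) h)
  intro a b ha hb
  obtain ⟨A, hA, h2⟩ := h1 a b ha hb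
  refine ⟨A, hA, fun R t hR ht hat htb => ?_⟩
  have h3 := h2 R t hR ht hat htb
  simp only at h3
  rwa [ENNReal.div_mul_cancel (invPow_pos h hR).ne' (invPow_lt_top h R).ne,
    ENNReal.div_mul_cancel (invPow_pos h ht).ne' (invPow_lt_top h t).ne] at h3

end InvPow

/-! ### The Luxemburg functional on balls -/

section Luxemburg

variable {n : ℕ} {Φ : ℝ≥0∞ → ℝ≥0∞}

theorem luxNorm_le {g : E n → ℝ≥0∞} {l : ℝ≥0∞} (h0 : 0 < l) (ht : l < ⊤)
    (h : ∫⁻ x, Φ (g x / l) ≤ 1) : luxNorm Φ g ≤ l := sInf_le ⟨h0, ht, h⟩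

theorem lintegral_le_one_of_luxNorm_lt (hΦ : IsYoung Φ) {g : E n → ℝ≥0∞} {l : ℝ≥0∞}
    (h : luxNorm Φ g < l) : ∫⁻ x, Φ (g x / l) ≤ 1 := by
  obtain ⟨m, ⟨-, -, hm⟩, hml⟩ := sInf_lt_iff.1 h
  refine le_trans (lintegral_mono fun x => hΦ.mono ?_) hm
  gcongr

theorem luxNorm_mono (hΦ : IsYoung Φ) {g h : E n → ℝ≥0∞} (hgh : ∀ x, g x ≤ h x) :
    luxNorm Φ g ≤ luxNorm Φ h := by
  refine sInf_le_sInf fun l hl => ⟨hl.1, hl.2.1, le_trans (lintegral_mono fun x => hΦ.mono ?_) hl.2.2⟩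
  have := hgh x
  gcongr

theorem le_mul_luxNorm {g : E n → ℝ≥0∞} {A K : ℝ≥0∞} (hK0 : K ≠ 0) (hK : K ≠ ⊤)
    (h : ∀ l : ℝ≥0∞, 0 < l → l < ⊤ → ∫⁻ x, Φ (g x / l) ≤ 1 → A ≤ K * l) :
    A ≤ K * luxNorm Φ g := by
  have : A / K ≤ luxNorm Φ g := le_sInf fun l hl =>
    ENNReal.div_le_of_le_mul ((h l hl.1 hl.2.1 hl.2.2).trans_eq (mul_comm _ _))
  rw [ENNReal.div_le_iff_le_mul (Or.inl hK0) (Or.inl hK)] at this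
  exact this.trans_eq (mul_comm _ _)

/-- The volume of the unit ball. -/
noncomputable def ballVol (n : ℕ) : ℝ≥0 := (volume (Metric.ball (0 : E n) 1)).toNNReal

theorem coe_ballVol : (ballVol n : ℝ≥0∞) = volume (Metric.ball (0 : E n) 1) :=
  ENNReal.coe_toNNReal measure_ball_lt_top.ne

theorem ballVol_pos : 0 < ballVol n := by
  rw [← ENNReal.coe_pos, coe_ballVol]
  exact Metric.measure_ball_pos _ _ one_pos

theorem volume_ball (x : E n) {r : ℝ} (hr : 0 < r) :
    volume (Metric.ball x r) = ENNReal.ofReal (r ^ n) * ballVol n := by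
  rw [coe_ballVol, Measure.addHaar_ball_of_pos _ _ hr]
  simp

theorem volume_closedBall (x : E n) {r : ℝ} (hr : 0 < r) :
    volume (Metric.closedBall x r) = ENNReal.ofReal (r ^ n) * ballVol n := by
  rw [coe_ballVol, Measure.addHaar_closedBall _ _ hr.le]
  simp

/-- The constant comparing `Φ⁻¹(r⁻ⁿ)` with `Φ⁻¹(|B(x,r)|⁻¹)`. -/
noncomputable def ballConst (n : ℕ) : ℝ≥0 := max 1 (max (ballVol n) (ballVol n)⁻¹)

theorem one_le_ballConst : 1 ≤ ballConst n := le_max_left _ _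

theorem inv_volume_ball (x : E n) {r : ℝ} (hr : 0 < r) :
    (volume (Metric.ball x r))⁻¹ = ((ballVol n)⁻¹ : ℝ≥0) * ENNReal.ofReal ((r ^ n)⁻¹) := by
  rw [volume_ball x hr, ENNReal.mul_inv (Or.inr ENNReal.coe_ne_top) (Or.inl ENNReal.ofReal_ne_top),
    ENNReal.coe_inv ballVol_pos.ne', ENNReal.ofReal_inv_of_pos (by positivity), mul_comm]

theorem youngInv_inv_volume_le (hΦ : IsYoung Φ) (x : E n) {r : ℝ} (hr : 0 < r) :
    youngInv Φ (volume (Metric.ball x r))⁻¹ ≤ ballConst n * invPow n Φ r := by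
  rw [inv_volume_ball x hr]
  refine (youngInv_mul_le' hΦ _ _).trans ?_
  rw [invPow, ballConst]
  gcongr
  exact le_max_right _ _

theorem invPow_le_youngInv_inv_volume (hΦ : IsYoung Φ) (x : E n) {r : ℝ} (hr : 0 < r) :
    invPow n Φ r ≤ ballConst n * youngInv Φ (volume (Metric.ball x r))⁻¹ := by
  have h1 : ENNReal.ofReal ((r ^ n)⁻¹) = ballVol n * (volume (Metric.ball x r))⁻¹ := by
    rw [inv_volume_ball x hr, ← mul_assoc, ← ENNReal.coe_mul, mul_inv_cancel₀ ballVol_pos.ne',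
      ENNReal.coe_one, one_mul]
  rw [invPow, h1]
  refine (youngInv_mul_le' hΦ _ _).trans ?_
  rw [ballConst]
  gcongr
  exact le_max_left _ _

theorem volume_ball_pos (x : E n) {r : ℝ} (hr : 0 < r) : 0 < volume (Metric.ball x r) :=
  Metric.measure_ball_pos _ _ hr

/-- Jensen's inequality at the level s = 1/|B|, with Φ⁻¹(1/|B|) replaced by the comparable Φ⁻¹(r⁻ⁿ).
-/
theorem setLIntegral_ball_le_of_modular (hΦ : IsYoung Φ) (x : E n) {r : ℝ} (hr : 0 < r)
    {g : E n → ℝ≥0∞} (hg : ∫⁻ y in Metric.ball x r, Φ (g y) ≤ 1) :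
    ∫⁻ y in Metric.ball x r, g y ≤
      (2 * ballConst n * ballVol n : ℝ≥0) * (ENNReal.ofReal (r ^ n) * invPow n Φ r) := by
  have hv0 := (volume_ball_pos x hr).ne'
  have hvt : volume (Metric.ball x r) ≠ ⊤ := measure_ball_lt_top.ne
  have : IsFiniteMeasure (volume.restrict (Metric.ball x r)) := ⟨by
    rw [Measure.restrict_apply_univ]; exact measure_ball_lt_top⟩
  have h1 := hΦ.lintegral_le_youngInv (μ := volume.restrict (Metric.ball x r)) (g := g)
    (ENNReal.inv_pos.2 hvt) (ENNReal.inv_lt_top.2 (volume_ball_pos x hr))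
    (by rwa [Measure.restrict_apply_univ, ENNReal.inv_mul_cancel hv0 hvt])
  rw [Measure.restrict_apply_univ] at h1
  calc _ ≤ _ := h1
    _ ≤ 2 * (ballConst n * invPow n Φ r) * (ENNReal.ofReal (r ^ n) * ballVol n) := by
        rw [← volume_ball x hr]
        gcongr
        exact youngInv_inv_volume_le hΦ x hr
    _ = _ := by push_cast; ring

theorem setLIntegral_ball_le_luxNorm (hΦ : IsYoung Φ) (x : E n) {r : ℝ} (hr : 0 < r)
    (g : E n → ℝ≥0∞) :
    ∫⁻ y in Metric.ball x r, g y ≤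
      (2 * ballConst n * ballVol n : ℝ≥0) * (ENNReal.ofReal (r ^ n) * invPow n Φ r) *
        luxNorm Φ ((Metric.ball x r).indicator g) := by
  have hK0 : (2 * ballConst n * ballVol n : ℝ≥0) ≠ 0 :=
    (mul_pos (mul_pos two_pos (zero_lt_one.trans_le one_le_ballConst)) ballVol_pos).ne'
  refine le_mul_luxNorm ?_ ?_ fun l hl0 hlt hl => ?_
  · refine mul_ne_zero (by exact_mod_cast hK0) (mul_ne_zero ?_ (invPow_pos hΦ hr).ne')
    exact (ENNReal.ofReal_pos.2 (by positivity)).ne'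
  · exact ENNReal.mul_ne_top ENNReal.coe_ne_top
      (ENNReal.mul_ne_top ENNReal.ofReal_ne_top (invPow_lt_top hΦ r).ne)
  · have h1 : ∫⁻ y in Metric.ball x r, Φ (g y / l) ≤ 1 := by
      refine le_trans (le_of_eq ?_) ((setLIntegral_le_lintegral (Metric.ball x r) _).trans hl)
      refine setLIntegral_congr_fun Metric.isOpen_ball.measurableSet fun y hy => ?_
      simp [indicator_of_mem hy]
    have h2 := setLIntegral_ball_le_of_modular hΦ x hr h1
    have h3 : ∫⁻ y in Metric.ball x r, g y = (∫⁻ y in Metric.ball x r, g y / l) * l := by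
      rw [← lintegral_mul_const' _ _ hlt.ne]
      simp only [ENNReal.div_mul_cancel hl0.ne' hlt.ne]
    rw [h3]
    gcongr

theorem lintegral_indicator_const_le (hΦ : IsYoung Φ) {A B : Set (E n)} (hB : MeasurableSet B)
    (hAB : A ⊆ B) (c l : ℝ≥0∞) :
    ∫⁻ x, Φ (A.indicator (fun _ => c) x / l) ≤ Φ (c / l) * volume B := by
  rw [← lintegral_indicator_const hB]
  refine lintegral_mono fun x => ?_
  by_cases hx : x ∈ A
  · simp [hx, hAB hx]
  · simp [hx, hΦ.map_zero]

/-- For the whole ball, Φ(c/l)|B| ≤ 1 means c/l ≤ Φ⁻¹(1/|B|). Comparing the modular of a subset with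
that of the ball avoids measurability of A. -/
theorem luxNorm_indicator_const_le (hΦ : IsYoung Φ) {x : E n} {r : ℝ} (hr : 0 < r)
    {A : Set (E n)} (hA : A ⊆ Metric.ball x r) {c : ℝ≥0∞} (hc : c ≠ ⊤) :
    luxNorm Φ (A.indicator fun _ => c) ≤ ballConst n * c / invPow n Φ r := by
  rcases eq_or_ne c 0 with rfl | hc0
  · have : luxNorm Φ (A.indicator fun _ => (0 : ℝ≥0∞)) = 0 := by
      refine le_antisymm (le_of_forall_gt fun l hl => ?_) zero_le
      obtain ⟨m, hm0, hml⟩ := exists_between hl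
      refine (luxNorm_le hm0 (hml.trans_le le_top) ?_).trans_lt hml
      simp [hΦ.map_zero]
    rw [this]
    exact zero_le
  have hK0 : (ballConst n : ℝ≥0∞) ≠ 0 := by
    simpa using (zero_lt_one.trans_le one_le_ballConst).ne'
  have hi0 := (invPow_pos (n := n) hΦ hr).ne'
  have hit := (invPow_lt_top (n := n) hΦ r).ne
  have hv0 := (volume_ball_pos x hr).ne'
  have hvt : volume (Metric.ball x r) ≠ ⊤ := measure_ball_lt_top.ne
  refine luxNorm_le (ENNReal.div_pos (mul_ne_zero hK0 hc0) hit)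
    (ENNReal.div_lt_top (ENNReal.mul_ne_top ENNReal.coe_ne_top hc) hi0) ?_
  refine (lintegral_indicator_const_le hΦ Metric.isOpen_ball.measurableSet hA _ _).trans ?_
  have h1 : c / (ballConst n * c / invPow n Φ r) ≤ youngInv Φ (volume (Metric.ball x r))⁻¹ := by
    refine ENNReal.div_le_of_le_mul ?_
    rw [← mul_div_assoc, ENNReal.le_div_iff_mul_le (Or.inl hi0) (Or.inl hit), mul_comm]
    refine (mul_le_mul_left (invPow_le_youngInv_inv_volume hΦ x hr) c).trans_eq ?_
    ring
  refine (mul_le_mul_left (hΦ.le_youngInv_iff.1 h1) _).trans_eq ?_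
  exact ENNReal.inv_mul_cancel hv0 hvt

end Luxemburg

/-! ### The centred maximal function and its weak type bounds -/

section Maximal

variable {n : ℕ}

/-- The Hardy--Littlewood maximal function. -/
noncomputable def maximal (g : E n → ℝ≥0∞) (x : E n) : ℝ≥0∞ :=
  ⨆ (r : ℝ) (_ : 0 < r), (∫⁻ y in Metric.ball x r, g y) / volume (Metric.ball x r)

theorem setLIntegral_ball_le_maximal (g : E n → ℝ≥0∞) (x : E n) {r : ℝ} (hr : 0 < r) :
    ∫⁻ y in Metric.ball x r, g y ≤ volume (Metric.ball x r) * maximal g x := by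
  have h1 : (∫⁻ y in Metric.ball x r, g y) / volume (Metric.ball x r) ≤ maximal g x :=
    le_iSup₂ (f := fun (r : ℝ) (_ : 0 < r) =>
      (∫⁻ y in Metric.ball x r, g y) / volume (Metric.ball x r)) r hr
  rw [ENNReal.div_le_iff_le_mul (Or.inl (volume_ball_pos x hr).ne')
    (Or.inl measure_ball_lt_top.ne)] at h1
  exact h1.trans_eq (mul_comm _ _)

/-- Vitali covering: among the balls on which the average of h exceeds s, a disjoint subfamily has
fourfold enlargements covering the level set, whence 4ⁿ. Neither h nor the level set has to be
measurable. -/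
theorem mul_volume_lt_maximal_le (hn : 1 ≤ n) (h : E n → ℝ≥0∞) (s : ℝ≥0∞) :
    s * volume {x | s < maximal h x} ≤ 4 ^ n * ∫⁻ x, h x := by
  rcases eq_or_ne (∫⁻ x, h x) ⊤ with hI | hI
  · simp [hI]
  rcases eq_or_ne s 0 with rfl | hs0
  · simp
  rcases eq_or_ne s ⊤ with rfl | hst
  · simp
  have key : ∀ x, ∃ r : ℝ, s < maximal h x →
      0 < r ∧ s * volume (Metric.ball x r) < ∫⁻ y in Metric.ball x r, h y := by
    intro x
    by_cases hx : s < maximal h x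
    · obtain ⟨r, hr⟩ := lt_iSup_iff.1 hx
      obtain ⟨hr0, hr⟩ := lt_iSup_iff.1 hr
      refine ⟨r, fun _ => ⟨hr0, ?_⟩⟩
      rwa [ENNReal.lt_div_iff_mul_lt (Or.inl (volume_ball_pos x hr0).ne')
        (Or.inl measure_ball_lt_top.ne)] at hr
    · exact ⟨0, fun h => absurd h hx⟩
  choose r hr using key
  set t : Set (E n) := {x | s < maximal h x} with ht
  set M : ℝ≥0∞ := (∫⁻ x, h x) / s / ballVol n
  have hM : M ≠ ⊤ := (ENNReal.div_lt_top (ENNReal.div_lt_top hI hs0).ne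
    (by simpa using ballVol_pos.ne')).ne
  -- The covering lemma needs bounded radii. A radius r ≥ 1 satisfies r ≤ rⁿ, and the measure of a
  -- selected ball is at most (∫h)/s.
  have hR : ∀ x ∈ t, r x ≤ max 1 M.toReal := by
    intro x hx
    obtain ⟨h0, h1⟩ := hr x hx
    rcases le_total (r x) 1 with h2 | h2
    · exact h2.trans (le_max_left _ _)
    refine le_max_of_le_right ?_
    have h3 : ENNReal.ofReal (r x) ≤ M := by
      rw [ENNReal.le_div_iff_mul_le (Or.inr (ENNReal.div_pos (fun h0' => ?_) hst).ne')
        (Or.inl ENNReal.coe_ne_top), ENNReal.le_div_iff_mul_le (Or.inl hs0) (Or.inl hst)]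
      · calc ENNReal.ofReal (r x) * ballVol n * s
            ≤ ENNReal.ofReal (r x ^ n) * ballVol n * s := by
              gcongr
              exact le_self_pow₀ h2 (by omega)
          _ = s * volume (Metric.ball x (r x)) := by rw [volume_ball x h0, mul_comm]
          _ ≤ _ := h1.le.trans (setLIntegral_le_lintegral _ _)
      · have := h1.trans_le (setLIntegral_le_lintegral _ _)
        rw [h0'] at this
        exact not_lt_zero this
    rw [← ENNReal.ofReal_le_iff_le_toReal hM]
    exact h3
  obtain ⟨u, hut, hud, hu⟩ := Vitali.exists_disjoint_subfamily_covering_enlargement_closedBall t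
    (fun x => x) r _ hR 4 (by norm_num)
  have hcount : u.Countable := by
    refine hud.countable_of_nonempty_interior fun x hx => ?_
    rw [interior_closedBall _ (hr x (hut hx)).1.ne']
    exact Metric.nonempty_ball.2 (hr x (hut hx)).1
  have hcover : t ⊆ ⋃ x ∈ u, Metric.closedBall x (4 * r x) := by
    intro x hx
    obtain ⟨b, hb, hsub⟩ := hu x hx
    exact mem_biUnion hb (hsub (Metric.mem_closedBall_self (hr x hx).1.le))
  calc s * volume t ≤ s * ∑' x : u, volume (Metric.closedBall (x : E n) (4 * r x)) := by
        gcongr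
        exact (measure_mono hcover).trans (measure_biUnion_le _ hcount _)
    _ = ∑' x : u, s * volume (Metric.closedBall (x : E n) (4 * r x)) := by
        rw [ENNReal.tsum_mul_left]
    _ ≤ ∑' x : u, 4 ^ n * ∫⁻ y in Metric.closedBall (x : E n) (r x), h y := by
        refine ENNReal.tsum_le_tsum fun x => ?_
        obtain ⟨h0, h1⟩ := hr x (hut x.2)
        rw [volume_closedBall _ (by positivity : 0 < 4 * r x), mul_pow,
          ENNReal.ofReal_mul (by positivity)]
        have e4 : ENNReal.ofReal (4 ^ n) = 4 ^ n := by
          rw [ENNReal.ofReal_pow (by norm_num)]; norm_num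
        rw [e4]
        calc s * (4 ^ n * ENNReal.ofReal (r x ^ n) * ballVol n)
            = 4 ^ n * (s * volume (Metric.ball (x : E n) (r x))) := by
              rw [volume_ball _ h0]; ring
          _ ≤ 4 ^ n * ∫⁻ y in Metric.ball (x : E n) (r x), h y := by gcongr
          _ ≤ _ := by gcongr; exact Metric.ball_subset_closedBall
    _ = 4 ^ n * ∑' x : u, ∫⁻ y in Metric.closedBall (x : E n) (r x), h y := by
        rw [ENNReal.tsum_mul_left]
    _ = 4 ^ n * ∫⁻ y in ⋃ x ∈ u, Metric.closedBall x (r x), h y := by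
        rw [lintegral_biUnion hcount (fun _ _ => Metric.isClosed_closedBall.measurableSet) hud]
    _ ≤ _ := by gcongr; exact Measure.restrict_le_self

variable {Φ : ℝ≥0∞ → ℝ≥0∞}

theorem maximal_le_add (f : E n → ℝ≥0∞) (c : ℝ≥0∞) (x : E n) {g : E n → ℝ≥0∞}
    (hfg : ∀ y, f y ≤ g y + c) : maximal f x ≤ maximal g x + c := by
  refine iSup₂_le fun r hr => ?_
  refine ENNReal.div_le_of_le_mul ?_
  calc ∫⁻ y in Metric.ball x r, f y ≤ ∫⁻ y in Metric.ball x r, (g y + c) :=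
        lintegral_mono fun y => hfg y
    _ = (∫⁻ y in Metric.ball x r, g y) + c * volume (Metric.ball x r) := by
        rw [lintegral_add_right _ measurable_const, setLIntegral_const]
    _ ≤ _ := by
        rw [add_mul]
        gcongr
        rw [mul_comm]
        exact setLIntegral_ball_le_maximal g x hr

/-- Jensen on each ball; the 2 in the argument pays for the factor lost there. It reduces weak
estimates for Φ(M·) to the weak (1,1) bound for Φ∘g. -/
theorem map_maximal_half_le (hΦ : IsYoung Φ) (g : E n → ℝ≥0∞) (x : E n) :
    Φ (maximal (fun y => g y / 2) x) ≤ maximal (fun y => Φ (g y)) x := by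
  refine le_of_forall_gt_imp_ge_of_dense fun s hs => ?_
  rcases eq_or_ne s ⊤ with rfl | hst
  · exact le_top
  have hs0 : 0 < s := zero_le.trans_lt hs
  rw [← hΦ.le_youngInv_iff]
  refine iSup₂_le fun r hr => ?_
  refine ENNReal.div_le_of_le_mul ?_
  have : IsFiniteMeasure (volume.restrict (Metric.ball x r)) := ⟨by
    rw [Measure.restrict_apply_univ]; exact measure_ball_lt_top⟩
  have h1 := hΦ.lintegral_le_youngInv (μ := volume.restrict (Metric.ball x r)) (g := g)
    hs0 (lt_top_iff_ne_top.2 hst) (by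
      rw [Measure.restrict_apply_univ, mul_comm]
      refine (setLIntegral_ball_le_maximal _ x hr).trans ?_
      gcongr)
  rw [Measure.restrict_apply_univ] at h1
  simp only [div_eq_mul_inv]
  rw [lintegral_mul_const' _ _ (by simp), ← div_eq_mul_inv]
  refine ENNReal.div_le_of_le_mul (h1.trans_eq (by ring))

/-- The part of f not exceeding a/2 contributes at most a/2 to the maximal function, so the weak
(1,1) bound at height a/2 is needed only for the part of f above a/2. -/
theorem mul_volume_lt_maximal_le' (hn : 1 ≤ n) (f : E n → ℝ≥0∞) (a : ℝ≥0∞) :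
    a * volume {x | a < maximal f x} ≤
      2 * 4 ^ n * ∫⁻ x, {v : ℝ≥0∞ | a < 2 * v}.indicator (fun v => v) (f x) := by
  set g : E n → ℝ≥0∞ := fun x => {v : ℝ≥0∞ | a < 2 * v}.indicator (fun v => v) (f x) with hg
  have h1 : ∀ y, f y ≤ g y + a / 2 := by
    intro y
    by_cases hy : a < 2 * f y
    · rw [hg]; simp [hy]
    · refine le_trans ?_ le_add_self
      rw [ENNReal.le_div_iff_mul_le (by simp) (by simp), mul_comm]
      exact not_lt.1 hy
  have h2 : {x | a < maximal f x} ⊆ {x | a / 2 < maximal g x} := by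
    intro x hx
    have h3 : a < maximal g x + a / 2 := lt_of_lt_of_le hx (maximal_le_add f _ x h1)
    by_contra h4
    have h5 : maximal g x ≤ a / 2 := not_lt.1 h4
    have h6 := h3.trans_le (add_le_add_left h5 (a / 2))
    rw [ENNReal.add_halves] at h6
    exact lt_irrefl _ h6
  calc a * volume {x | a < maximal f x} ≤ 2 * (a / 2 * volume {x | a / 2 < maximal g x}) := by
        rw [← mul_assoc, ENNReal.mul_div_cancel (by simp) (by simp)]
        gcongr
    _ ≤ 2 * (4 ^ n * ∫⁻ x, g x) := by
        exact mul_le_mul_right (mul_volume_lt_maximal_le hn g _) 2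
    _ = _ := by rw [mul_assoc]

end Maximal

/-! ### Modular boundedness of the maximal operator under ∇₂ -/

section Nabla

variable {n : ℕ} {Φ : ℝ≥0∞ → ℝ≥0∞}

/-- A discrete layer-cake bound: for finite w > 0 the single term with aᵏ < w ≤ aᵏ⁺¹ is enough. At w
= ∞ every term is active and Φ → ∞ makes the sum infinite. -/
theorem map_le_tsum_zpow (hΦ : IsYoung Φ) {a : ℝ≥0∞} (ha : 1 < a) (hat : a ≠ ⊤) (w : ℝ≥0∞) :
    Φ w ≤ ∑' k : ℤ, Φ (a ^ (k + 1)) * {v : ℝ≥0∞ | a ^ k < v}.indicator 1 w := by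
  rcases eq_or_ne w 0 with rfl | hw0
  · simp [hΦ.map_zero]
  rcases eq_or_ne w ⊤ with rfl | hwt
  · refine le_of_forall_lt fun s hs => ?_
    rw [hΦ.map_top] at hs
    obtain ⟨u, hut, hu⟩ := hΦ.exists_lt_map hs
    have hu0 : u ≠ 0 := by
      rintro rfl
      rw [hΦ.map_zero] at hu
      exact not_lt_zero hu
    obtain ⟨k, -, hk⟩ := ENNReal.exists_mem_Ioc_zpow hu0 hut.ne ha hat
    refine (hu.trans_le (hΦ.mono hk)).trans_le ?_
    refine le_trans ?_ (ENNReal.le_tsum k)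
    have : a ^ k < ⊤ := ENNReal.zpow_lt_top (zero_lt_one.trans ha).ne' hat k
    simp [this]
  · obtain ⟨k, hk1, hk⟩ := ENNReal.exists_mem_Ioc_zpow hw0 hwt ha hat
    refine (hΦ.mono hk).trans ?_
    refine le_trans ?_ (ENNReal.le_tsum k)
    simp [hk1]

/-- The ∇₂ inequality says that c_k = Φ(aᵏ⁺¹)/aᵏ at least doubles with k. The sum is thus geometric
and controlled by its last term, the k with aᵏ < 2v ≤ aᵏ⁺¹. -/
theorem tsum_zpow_le (hΦ : IsYoung Φ) {a : ℝ≥0∞} (ha : 1 < a) (hat : a ≠ ⊤)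
    (h : ∀ r, Φ r ≤ Φ (a * r) / (2 * a)) (v : ℝ≥0∞) :
    ∑' k : ℤ, Φ (a ^ (k + 1)) / a ^ k * {v : ℝ≥0∞ | a ^ k < 2 * v}.indicator (fun v => v) v ≤
      a * Φ (2 * a * v) := by
  have ha0 : a ≠ 0 := (zero_lt_one.trans ha).ne'
  rcases eq_or_ne v 0 with rfl | hv0
  · simp
  rcases eq_or_ne v ⊤ with rfl | hvt
  · rw [ENNReal.mul_top (mul_ne_zero two_ne_zero ha0), hΦ.map_top, ENNReal.mul_top ha0]
    exact le_top
  obtain ⟨m, hm1, hm2⟩ := ENNReal.exists_mem_Ioc_zpow (x := 2 * v) (by simp [hv0])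
    (ENNReal.mul_ne_top (by simp) hvt) ha hat
  have hp0 : ∀ k : ℤ, a ^ k ≠ 0 := fun k => (ENNReal.zpow_pos ha0 hat k).ne'
  have hpt : ∀ k : ℤ, a ^ k ≠ ⊤ := fun k => (ENNReal.zpow_lt_top ha0 hat k).ne
  set c : ℤ → ℝ≥0∞ := fun k => Φ (a ^ (k + 1)) / a ^ k with hc
  have hstep : ∀ k, c k ≤ 2⁻¹ * c (k + 1) := by
    intro k
    have h1 := h (a ^ (k + 1))
    have e1 : a * a ^ (k + 1) = a ^ (k + 1 + 1) := by
      rw [ENNReal.zpow_add ha0 hat (k + 1) 1, zpow_one, mul_comm]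
    rw [e1] at h1
    calc c k ≤ Φ (a ^ (k + 1 + 1)) / (2 * a) / a ^ k := ENNReal.div_le_div_right h1 _
      _ = 2⁻¹ * c (k + 1) := by
        rw [hc]
        simp only [div_eq_mul_inv]
        rw [ENNReal.zpow_add ha0 hat k 1, zpow_one,
          ENNReal.mul_inv (Or.inl (by simp)) (Or.inl (by simp)),
          ENNReal.mul_inv (Or.inl (hp0 k)) (Or.inl (hpt k))]
        ring
  have hpow : ∀ j : ℕ, c (m - j) ≤ 2⁻¹ ^ j * c m := by
    intro j
    induction j with
    | zero => simp
    | succ j ih =>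
      refine (hstep _).trans ?_
      rw [pow_succ', mul_assoc]
      have : m - ((j + 1 : ℕ) : ℤ) + 1 = m - j := by push_cast; ring
      rw [this]
      gcongr
  rw [← (Equiv.subLeft m).tsum_eq]
  -- With k = m - j, a negative j means k ≥ m + 1, where aᵏ ≥ 2v and the indicator vanishes; the sum
  -- is over ℕ.
  have hsupp : Function.support (fun j : ℤ => Φ (a ^ (m - j + 1)) / a ^ (m - j) *
      {v : ℝ≥0∞ | a ^ (m - j) < 2 * v}.indicator (fun v => v) v) ⊆ range (Nat.cast : ℕ → ℤ) := by
    intro j hj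
    by_contra hj'
    have hjneg : j < 0 := by
      by_contra h0
      exact hj' ⟨j.toNat, Int.toNat_of_nonneg (not_lt.1 h0)⟩
    refine hj ?_
    have : ¬ a ^ (m - j) < 2 * v := not_lt.2 (hm2.trans (ENNReal.zpow_le_of_le ha.le (by omega)))
    simp [this]
  simp only [Equiv.subLeft_apply]
  rw [← Function.Injective.tsum_eq Nat.cast_injective hsupp]
  calc _ ≤ ∑' j : ℕ, 2⁻¹ ^ j * (c m * v) := by
        refine ENNReal.tsum_le_tsum fun j => ?_
        rw [← mul_assoc]
        exact mul_le_mul' (hpow j) (indicator_apply_le' (fun _ => le_rfl) (fun _ => zero_le))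
    _ = 2 * (c m * v) := by
        rw [ENNReal.tsum_mul_right, ENNReal.tsum_geometric, ENNReal.one_sub_inv_two, inv_inv]
    _ = Φ (a ^ (m + 1)) * (2 * v / a ^ m) := by rw [hc]; simp only [div_eq_mul_inv]; ring
    _ ≤ Φ (2 * a * v) * a := by
        gcongr
        · refine hΦ.mono ?_
          rw [ENNReal.zpow_add ha0 hat, zpow_one, mul_right_comm]
          gcongr
        · refine ENNReal.div_le_of_le_mul ?_
          rw [ENNReal.zpow_add ha0 hat, zpow_one] at hm2
          exact hm2.trans_eq (mul_comm _ _)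
    _ = _ := mul_comm _ _

/-- Marcinkiewicz interpolation on the levels aᵏ: the layer-cake bound, the truncated weak type
bound at each level, then summation under the integral by ∇₂. -/
theorem lintegral_map_maximal_le (hn : 1 ≤ n) (hΦ : IsYoung Φ) {a : ℝ≥0∞} (ha : 1 < a)
    (hat : a ≠ ⊤) (h : ∀ r, Φ r ≤ Φ (a * r) / (2 * a)) {f : E n → ℝ≥0∞}
    (hf : AEMeasurable f) :
    ∫⁻ x, Φ (maximal f x) ≤ 2 * 4 ^ n * a * ∫⁻ x, Φ (2 * a * f x) := by
  have ha0 : a ≠ 0 := (zero_lt_one.trans ha).ne'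
  have hp0 : ∀ k : ℤ, a ^ k ≠ 0 := fun k => (ENNReal.zpow_pos ha0 hat k).ne'
  have hpt : ∀ k : ℤ, a ^ k ≠ ⊤ := fun k => (ENNReal.zpow_lt_top ha0 hat k).ne
  have hG : ∀ k : ℤ, Measurable fun v : ℝ≥0∞ =>
      {v : ℝ≥0∞ | a ^ k < 2 * v}.indicator (fun v => v) v := fun k =>
    measurable_id.indicator (measurableSet_lt measurable_const (measurable_id.const_mul _))
  have hGf : ∀ k : ℤ, AEMeasurable fun x =>
      {v : ℝ≥0∞ | a ^ k < 2 * v}.indicator (fun v => v) (f x) := fun k =>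
    (hG k).comp_aemeasurable hf
  set S : ℤ → Set (E n) := fun k => toMeasurable volume {x | a ^ k < maximal f x} with hS
  have hSm : ∀ k, MeasurableSet (S k) := fun k => measurableSet_toMeasurable _ _
  calc ∫⁻ x, Φ (maximal f x)
      ≤ ∫⁻ x, ∑' k : ℤ, Φ (a ^ (k + 1)) * (S k).indicator 1 x := by
        refine lintegral_mono fun x => (map_le_tsum_zpow hΦ ha hat _).trans ?_
        refine ENNReal.tsum_le_tsum fun k => mul_le_mul_right ?_ _
        by_cases hx : a ^ k < maximal f x
        · have : x ∈ S k := subset_toMeasurable _ _ hx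
          simp [hx, this]
        · simp [hx]
    _ = ∑' k : ℤ, Φ (a ^ (k + 1)) * volume {x | a ^ k < maximal f x} := by
        rw [lintegral_tsum fun k =>
          ((measurable_one.indicator (hSm k)).const_mul _).aemeasurable]
        refine tsum_congr fun k => ?_
        rw [lintegral_const_mul _ (measurable_one.indicator (hSm k)),
          lintegral_indicator_one (hSm k), hS, measure_toMeasurable]
    _ ≤ ∑' k : ℤ, 2 * 4 ^ n * ∫⁻ x, Φ (a ^ (k + 1)) / a ^ k *
          {v : ℝ≥0∞ | a ^ k < 2 * v}.indicator (fun v => v) (f x) := by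
        refine ENNReal.tsum_le_tsum fun k => ?_
        rw [lintegral_const_mul'' _ (hGf k)]
        calc Φ (a ^ (k + 1)) * volume {x | a ^ k < maximal f x}
            = Φ (a ^ (k + 1)) / a ^ k * (a ^ k * volume {x | a ^ k < maximal f x}) := by
              rw [← mul_assoc, ENNReal.div_mul_cancel (hp0 k) (hpt k)]
          _ ≤ Φ (a ^ (k + 1)) / a ^ k * (2 * 4 ^ n *
                ∫⁻ x, {v : ℝ≥0∞ | a ^ k < 2 * v}.indicator (fun v => v) (f x)) :=
              mul_le_mul_right (mul_volume_lt_maximal_le' hn f _) _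
          _ = _ := by ring
    _ = 2 * 4 ^ n * ∫⁻ x, ∑' k : ℤ, Φ (a ^ (k + 1)) / a ^ k *
          {v : ℝ≥0∞ | a ^ k < 2 * v}.indicator (fun v => v) (f x) := by
        rw [ENNReal.tsum_mul_left, lintegral_tsum fun k =>
          (hGf k).const_mul _]
    _ ≤ 2 * 4 ^ n * ∫⁻ x, a * Φ (2 * a * f x) := by
        gcongr with x
        exact tsum_zpow_le hΦ ha hat h _
    _ = _ := by
        rw [lintegral_const_mul' _ _ hat]
        ring

/-- For `Φ ∈ ∇₂` the maximal operator is bounded on `L^Φ`. -/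
theorem exists_lintegral_map_maximal_le_one (hn : 1 ≤ n) (hΦ : IsYoung Φ) (h2 : Nabla2 Φ) :
    ∃ c : ℝ≥0, 0 < c ∧ c ≤ 1 ∧ ∀ g : E n → ℝ≥0∞, AEMeasurable g → ∫⁻ x, Φ (g x) ≤ 1 →
      ∫⁻ x, Φ (maximal (fun y => c * g y) x) ≤ 1 := by
  obtain ⟨a, ha, h⟩ := h2
  have ha0 : 0 < a := zero_lt_one.trans ha
  set K : ℝ≥0 := 2 * 4 ^ n * a with hK
  have hK1 : 1 ≤ K := by
    have h4 : (1 : ℝ≥0) ≤ 4 ^ n := one_le_pow₀ (by norm_num)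
    calc (1 : ℝ≥0) = 1 * 1 * 1 := by norm_num
      _ ≤ 2 * 4 ^ n * a := by gcongr; norm_num
  have hK0 : 0 < K := zero_lt_one.trans_le hK1
  have h2a : 1 ≤ 2 * a := by
    calc (1 : ℝ≥0) = 1 * 1 := by norm_num
      _ ≤ 2 * a := by gcongr; norm_num
  -- The factor (2a)⁻¹ undoes the dilation inside Φ; K⁻¹ ≤ 1 comes out of Φ by convexity and cancels
  -- the constant K in front.
  refine ⟨(2 * a)⁻¹ * K⁻¹, by positivity,
    mul_le_one' (inv_le_one_of_one_le₀ h2a) (inv_le_one_of_one_le₀ hK1), fun g hg hg1 => ?_⟩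
  have hm := lintegral_map_maximal_le hn hΦ (by exact_mod_cast ha) ENNReal.coe_ne_top h
    (hg.const_mul (((2 * a)⁻¹ * K⁻¹ : ℝ≥0) : ℝ≥0∞))
  refine hm.trans ?_
  have e1 : ∀ x, 2 * (a : ℝ≥0∞) * ((((2 * a)⁻¹ * K⁻¹ : ℝ≥0) : ℝ≥0∞) * g x) =
      (K⁻¹ : ℝ≥0) * g x := by
    intro x
    rw [← mul_assoc]
    congr 1
    have : (2 * (a : ℝ≥0∞)) = ((2 * a : ℝ≥0) : ℝ≥0∞) := by push_cast; rfl
    rw [this, ← ENNReal.coe_mul, ← mul_assoc, mul_inv_cancel₀ (by positivity), one_mul]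
  simp only [e1]
  have e2 : (2 * 4 ^ n * (a : ℝ≥0∞)) = (K : ℝ≥0∞) := by rw [hK]; push_cast; rfl
  rw [e2]
  calc (K : ℝ≥0∞) * ∫⁻ x, Φ ((K⁻¹ : ℝ≥0) * g x)
      ≤ K * ∫⁻ x, (K⁻¹ : ℝ≥0) * Φ (g x) := by
        gcongr with x
        exact hΦ.map_mul_le (inv_le_one_of_one_le₀ hK1) _
    _ = ∫⁻ x, Φ (g x) := by
        rw [lintegral_const_mul' _ _ ENNReal.coe_ne_top, ← mul_assoc, ← ENNReal.coe_mul,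
          mul_inv_cancel₀ hK0.ne', ENNReal.coe_one, one_mul]
    _ ≤ 1 := hg1

end Nabla

/-! ### Dyadic estimates for the kernel -/

section Kernel

variable {n : ℕ} {ρ : ℝ → ℝ}

/-- The kernel `ρ(|z|) / |z|ⁿ`, with values in `[0,∞]`. -/
noncomputable def kernel (ρ : ℝ → ℝ) (z : E n) : ℝ≥0∞ := ENNReal.ofReal (ρ ‖z‖ / ‖z‖ ^ n)

/-- The generalized fractional integral of a function `g ≥ 0`, with values in `[0,∞]`. -/
noncomputable def potential (ρ : ℝ → ℝ) (g : E n → ℝ≥0∞) (x : E n) : ℝ≥0∞ :=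
  ∫⁻ y, kernel ρ (x - y) * g y

/-- The annulus `B(x,R) ∖ B(x,R/2)`. -/
def annulus (x : E n) (R : ℝ) : Set (E n) := Metric.ball x R \ Metric.ball x (R / 2)

/-- `sup_{r/2 ≤ t ≤ r} ρ(t) ≤ C ∫_{k r}^{2^N k r} ρ(t) dt/t` for all `r > 0`. -/
def SupBound (ρ : ℝ → ℝ) (C : ℝ≥0) (k : ℝ) (N : ℕ) : Prop :=
  0 < k ∧ ∀ r : ℝ, 0 < r → (⨆ t ∈ Icc (r / 2) r, ENNReal.ofReal (ρ t)) ≤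
    C * ∫⁻ t in Ioo (k * r) (k * r * 2 ^ N), ENNReal.ofReal (ρ t / t)

/-- Enlarging k₂/k₁ to a power of 2 makes each integration interval a union of N dyadic pieces, so
overlaps can be counted. -/
theorem SupCond.exists_supBound (h : SupCond ρ) : ∃ C k N, SupBound ρ C k N := by
  obtain ⟨C, k₁, k₂, -, hk₁, -, h⟩ := h
  obtain ⟨N, hN⟩ := pow_unbounded_of_one_lt (k₂ / k₁) (one_lt_two (α := ℝ))
  refine ⟨C, k₁, N, hk₁, fun r hr => (h r hr).trans ?_⟩
  refine mul_le_mul_right (lintegral_mono_set (Ioo_subset_Ioo_right ?_)) _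
  rw [div_lt_iff₀ hk₁] at hN
  calc k₂ * r ≤ 2 ^ N * k₁ * r := by gcongr
    _ = _ := by ring

theorem nontrivial_of_one_le (hn : 1 ≤ n) : Nontrivial (E n) := by
  have : Nonempty (Fin n) := ⟨⟨0, hn⟩⟩
  infer_instance

theorem setLIntegral_annulus_le {g : E n → ℝ≥0∞} (hg : AEMeasurable g) (x : E n) {R : ℝ}
    (hR : 0 < R) {F : ℝ≥0∞} (hF : ∫⁻ y in Metric.ball x R, g y ≤ ENNReal.ofReal (R ^ n) * F) :
    ∫⁻ y in annulus x R, kernel ρ (x - y) * g y ≤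
      2 ^ n * (⨆ t ∈ Icc (R / 2) R, ENNReal.ofReal (ρ t)) * F := by
  set s : ℝ≥0∞ := ⨆ t ∈ Icc (R / 2) R, ENNReal.ofReal (ρ t) with hs
  have hm : MeasurableSet (annulus x R) :=
    Metric.isOpen_ball.measurableSet.diff Metric.isOpen_ball.measurableSet
  have hker : ∀ y ∈ annulus x R, kernel ρ (x - y) ≤ s * ENNReal.ofReal (2 ^ n / R ^ n) := by
    intro y hy
    have h1 : ‖x - y‖ < R := by simpa [dist_eq_norm, norm_sub_rev] using hy.1
    have h2 : R / 2 ≤ ‖x - y‖ := by simpa [dist_eq_norm, norm_sub_rev] using hy.2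
    have h3 : ENNReal.ofReal (ρ ‖x - y‖) ≤ s :=
      le_iSup₂ (f := fun t (_ : t ∈ Icc (R / 2) R) => ENNReal.ofReal (ρ t)) ‖x - y‖ ⟨h2, h1.le⟩
    rw [kernel, div_eq_mul_inv, ENNReal.ofReal_mul' (by positivity)]
    refine mul_le_mul' h3 (ENNReal.ofReal_le_ofReal ?_)
    rw [← div_pow, ← inv_pow]
    refine pow_le_pow_left₀ (by positivity) ?_ n
    rw [← inv_div]
    exact inv_anti₀ (by positivity) h2
  calc ∫⁻ y in annulus x R, kernel ρ (x - y) * g y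
      ≤ ∫⁻ y in annulus x R, s * ENNReal.ofReal (2 ^ n / R ^ n) * g y :=
        setLIntegral_mono' hm fun y hy => mul_le_mul_left (hker y hy) _
    _ = s * ENNReal.ofReal (2 ^ n / R ^ n) * ∫⁻ y in annulus x R, g y :=
        lintegral_const_mul'' _ hg.restrict
    _ ≤ s * ENNReal.ofReal (2 ^ n / R ^ n) * (ENNReal.ofReal (R ^ n) * F) := by
        gcongr
        exact (lintegral_mono_set sdiff_subset).trans hF
    _ = s * (ENNReal.ofReal (2 ^ n / R ^ n) * ENNReal.ofReal (R ^ n)) * F := by ring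
    _ = 2 ^ n * s * F := by
        rw [← ENNReal.ofReal_mul (by positivity), div_mul_cancel₀ _ (by positivity),
          ENNReal.ofReal_pow (by norm_num), ENNReal.ofReal_ofNat, mul_comm s]

/-- Bounded overlap: since σ is injective, each dyadic interval lies in at most N of the long
intervals. -/
theorem tsum_setLIntegral_Ico_le {σ : ℕ → ℤ} (hσ : Function.Injective σ) {c : ℝ} (hc : 0 < c)
    (N : ℕ) {S : Set ℝ} (hS : ∀ j, Ico (c * 2 ^ σ j) (c * 2 ^ σ j * 2 ^ N) ⊆ S) (h : ℝ → ℝ≥0∞) :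
    ∑' j, ∫⁻ t in Ico (c * 2 ^ σ j) (c * 2 ^ σ j * 2 ^ N), h t ≤ N * ∫⁻ t in S, h t := by
  set J : ℤ → Set ℝ := fun m => Ico (c * 2 ^ m) (c * 2 ^ (m + 1)) with hJ
  have hmono : ∀ {a b : ℤ}, a ≤ b → c * (2 : ℝ) ^ a ≤ c * 2 ^ b := fun hab =>
    mul_le_mul_of_nonneg_left (zpow_le_zpow_right₀ one_le_two hab) hc.le
  have hdisj : Pairwise (Function.onFun Disjoint J) := by
    intro a b hab
    rw [Function.onFun, Set.disjoint_left]
    intro t ha hb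
    rcases lt_or_gt_of_ne hab with hlt | hlt
    · exact absurd (ha.2.trans_le (hmono (show a + 1 ≤ b by omega))) (not_lt.2 hb.1)
    · exact absurd (hb.2.trans_le (hmono (show b + 1 ≤ a by omega))) (not_lt.2 ha.1)
  have hsplit : ∀ j, Ico (c * 2 ^ σ j) (c * 2 ^ σ j * 2 ^ N) =
      ⋃ i ∈ Finset.range N, J (σ j + (i : ℕ)) := by
    intro j
    have : ∀ M : ℕ, Ico (c * 2 ^ σ j) (c * 2 ^ σ j * 2 ^ M) =
      ⋃ i ∈ Finset.range M, J (σ j + (i : ℕ)) := by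
      intro M
      induction M with
      | zero => simp
      | succ M ih =>
        rw [Finset.range_add_one, Finset.set_biUnion_insert, ← ih, hJ, union_comm]
        have e1 : c * (2 : ℝ) ^ (σ j + (M : ℤ)) = c * 2 ^ σ j * 2 ^ M := by
          rw [zpow_add₀ two_ne_zero, zpow_natCast, mul_assoc]
        have e2 : c * (2 : ℝ) ^ (σ j + (M : ℤ) + 1) = c * 2 ^ σ j * 2 ^ (M + 1) := by
          rw [zpow_add₀ two_ne_zero, zpow_add₀ two_ne_zero, zpow_natCast, zpow_one, pow_succ]
          ring
        simp only [e1, e2]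
        rw [Ico_union_Ico_eq_Ico]
        · exact le_mul_of_one_le_right (by positivity) (one_le_pow₀ one_le_two)
        · gcongr
          · exact one_le_two
          · omega
    exact this N
  calc ∑' j, ∫⁻ t in Ico (c * 2 ^ σ j) (c * 2 ^ σ j * 2 ^ N), h t
      ≤ ∑' j, ∑ i ∈ Finset.range N, ∫⁻ t in J (σ j + (i : ℕ)), h t := by
        refine ENNReal.tsum_le_tsum fun j => ?_
        rw [hsplit j]
        rw [lintegral_biUnion_finset (t := fun i : ℕ => J (σ j + (i : ℕ)))
          (fun a _ b _ hab => hdisj (by simpa using hab))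
          (fun i _ => measurableSet_Ico)]
    _ = ∑ i ∈ Finset.range N, ∑' j, ∫⁻ t in J (σ j + (i : ℕ)), h t :=
        Summable.tsum_finsetSum fun _ _ => ENNReal.summable
    _ ≤ ∑ i ∈ Finset.range N, ∫⁻ t in S, h t := by
        refine Finset.sum_le_sum fun i hi => ?_
        rw [← lintegral_iUnion (fun j => measurableSet_Ico)]
        · refine lintegral_mono_set (iUnion_subset fun j => ?_)
          refine Subset.trans ?_ (hS j)
          rw [hsplit j]
          exact subset_biUnion_of_mem (u := fun i : ℕ => J (σ j + (i : ℕ))) hi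
        · intro a b hab
          exact hdisj fun h => hab (hσ (by linarith))
    _ = N * ∫⁻ t in S, h t := by simp

/-- The common core of the near and far estimates. On the annulus of radius R the kernel is ≲ sup ρ
/ Rⁿ, `SupBound` turns the supremum into an integral over t ≈ R, F(R) is exchanged for G(t) inside
it, and bounded overlap sums the pieces. The centre is a null set as n ≥ 1. -/
theorem setLIntegral_kernel_le (hn : 1 ≤ n) {C : ℝ≥0} {k : ℝ} {N : ℕ} (hρ : SupBound ρ C k N)
    {g : E n → ℝ≥0∞} (hg : AEMeasurable g) (x : E n) {r : ℝ} (hr : 0 < r) {σ : ℕ → ℤ}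
    (hσ : Function.Injective σ) {Ω : Set (E n)}
    (hΩ : Ω ⊆ {x} ∪ ⋃ j, annulus x (r * 2 ^ σ j)) {F G : ℝ → ℝ≥0∞} {A : ℝ≥0}
    (hF : ∀ j, ∫⁻ y in Metric.ball x (r * 2 ^ σ j), g y ≤
      ENNReal.ofReal ((r * 2 ^ σ j) ^ n) * F (r * 2 ^ σ j))
    (hFG : ∀ R t, 0 < R → k * R ≤ t → t ≤ k * 2 ^ N * R → F R ≤ A * G t) {S : Set ℝ}
    (hS : ∀ j, Ico (k * r * 2 ^ σ j) (k * r * 2 ^ σ j * 2 ^ N) ⊆ S) :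
    ∫⁻ y in Ω, kernel ρ (x - y) * g y ≤
      (2 ^ n * C * A * N : ℝ≥0) * ∫⁻ t in S, ENNReal.ofReal (ρ t / t) * G t := by
  obtain ⟨hk, hρ⟩ := hρ
  have := nontrivial_of_one_le hn
  have hpt : ∫⁻ y in ({x} : Set (E n)), kernel ρ (x - y) * g y = 0 :=
    setLIntegral_measure_zero _ _ (measure_singleton x)
  calc ∫⁻ y in Ω, kernel ρ (x - y) * g y
      ≤ ∫⁻ y in {x} ∪ ⋃ j, annulus x (r * 2 ^ σ j), kernel ρ (x - y) * g y :=
        lintegral_mono_set hΩ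
    _ ≤ 0 + ∑' j, ∫⁻ y in annulus x (r * 2 ^ σ j), kernel ρ (x - y) * g y := by
        rw [← hpt]
        refine (lintegral_union_le _ _ _).trans ?_
        gcongr
        exact lintegral_iUnion_le _ _
    _ ≤ ∑' j, (2 ^ n * C * A : ℝ≥0) * ∫⁻ t in Ico (k * r * 2 ^ σ j) (k * r * 2 ^ σ j * 2 ^ N),
          ENNReal.ofReal (ρ t / t) * G t := by
        rw [zero_add]
        refine ENNReal.tsum_le_tsum fun j => ?_
        set R : ℝ := r * 2 ^ σ j with hR
        have hR0 : 0 < R := by positivity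
        refine (setLIntegral_annulus_le hg x hR0 (hF j)).trans ?_
        calc 2 ^ n * (⨆ t ∈ Icc (R / 2) R, ENNReal.ofReal (ρ t)) * F R
            ≤ 2 ^ n * (C * ∫⁻ t in Ioo (k * R) (k * R * 2 ^ N), ENNReal.ofReal (ρ t / t)) * F R := by
              gcongr
              exact hρ R hR0
          _ = 2 ^ n * C *
              ((∫⁻ t in Ioo (k * R) (k * R * 2 ^ N), ENNReal.ofReal (ρ t / t)) * F R) := by ring
          _ ≤ 2 ^ n * C *
              (A * ∫⁻ t in Ioo (k * R) (k * R * 2 ^ N), ENNReal.ofReal (ρ t / t) * G t) := by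
              -- Moving the constant F(R) into the integral in this direction requires no
              -- measurability of ρ.
              refine mul_le_mul_right ((lintegral_mul_const_le _ _).trans ?_) _
              rw [← lintegral_const_mul' _ _ ENNReal.coe_ne_top]
              refine setLIntegral_mono' measurableSet_Ioo fun t ht => ?_
              rw [mul_left_comm]
              gcongr
              exact hFG R t hR0 ht.1.le (ht.2.le.trans_eq (by ring))
          _ ≤ 2 ^ n * C * (A * ∫⁻ t in Ico (k * r * 2 ^ σ j) (k * r * 2 ^ σ j * 2 ^ N),
                ENNReal.ofReal (ρ t / t) * G t) := by
              rw [hR, ← mul_assoc k r]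
              gcongr
              exact Ioo_subset_Ico_self
          _ = _ := by push_cast; ring
    _ = (2 ^ n * C * A : ℝ≥0) * ∑' j, ∫⁻ t in Ico (k * r * 2 ^ σ j) (k * r * 2 ^ σ j * 2 ^ N),
          ENNReal.ofReal (ρ t / t) * G t := by rw [ENNReal.tsum_mul_left]
    _ ≤ (2 ^ n * C * A : ℝ≥0) * (N * ∫⁻ t in S, ENNReal.ofReal (ρ t / t) * G t) := by
        gcongr
        exact tsum_setLIntegral_Ico_le hσ (by positivity) N hS _
    _ = _ := by push_cast; ring

theorem ball_subset_iUnion_annulus (x : E n) {r : ℝ} (hr : 0 < r) :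
    Metric.ball x r ⊆ {x} ∪ ⋃ j : ℕ, annulus x (r * 2 ^ (-(j : ℤ))) := by
  intro y hy
  rcases eq_or_ne y x with rfl | hyx
  · exact Or.inl rfl
  right
  have hd : 0 < dist y x := dist_pos.2 hyx
  obtain ⟨m, hm1, hm2⟩ := exists_mem_Ico_zpow (div_pos hd hr) (one_lt_two (α := ℝ))
  rw [le_div_iff₀ hr] at hm1
  rw [div_lt_iff₀ hr] at hm2
  have hm0 : m + 1 ≤ 0 := by
    by_contra! h
    have h1 : (1 : ℝ) ≤ 2 ^ m := one_le_zpow₀ one_le_two (by omega)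
    have h2 : dist y x < r := hy
    nlinarith
  -- As 2ᵐ ≤ dist/r < 2ᵐ⁺¹, the annulus has outer radius r·2ᵐ⁺¹; dist < r makes m + 1 ≤ 0.
  refine mem_iUnion.2 ⟨(-(m + 1)).toNat, ?_, ?_⟩
  · rw [Metric.mem_ball, Int.toNat_of_nonneg (by omega), neg_neg, mul_comm]
    exact hm2
  · rw [Metric.mem_ball, Int.toNat_of_nonneg (by omega), neg_neg, not_lt,
      zpow_add₀ two_ne_zero, zpow_one]
    linarith

theorem compl_ball_subset_iUnion_annulus (x : E n) {r : ℝ} (hr : 0 < r) :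
    (Metric.ball x r)ᶜ ⊆ {x} ∪ ⋃ j : ℕ, annulus x (r * 2 ^ ((j : ℤ) + 1)) := by
  intro y hy
  right
  have hd : r ≤ dist y x := not_lt.1 hy
  obtain ⟨m, hm1, hm2⟩ := exists_mem_Ico_zpow (div_pos (hr.trans_le hd) hr) (one_lt_two (α := ℝ))
  rw [le_div_iff₀ hr] at hm1
  rw [div_lt_iff₀ hr] at hm2
  have hm0 : 0 ≤ m := by
    by_contra! h
    have h1 : (2 : ℝ) ^ (m + 1) ≤ 1 := zpow_le_one_of_nonpos₀ one_le_two (by omega)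
    nlinarith
  refine mem_iUnion.2 ⟨m.toNat, ?_, ?_⟩
  · rw [Metric.mem_ball, Int.toNat_of_nonneg hm0, mul_comm]
    exact hm2
  · rw [Metric.mem_ball, Int.toNat_of_nonneg hm0, not_lt, zpow_add₀ two_ne_zero, zpow_one]
    linarith

/-- The near part: all averages of g around x are at most c, so F and G are constant. -/
theorem setLIntegral_ball_kernel_le (hn : 1 ≤ n) {C : ℝ≥0} {k : ℝ} {N : ℕ}
    (hρ : SupBound ρ C k N) {g : E n → ℝ≥0∞} (hg : AEMeasurable g) (x : E n) {r : ℝ} (hr : 0 < r)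
    {c : ℝ≥0∞} (hc : c ≠ ⊤) (hgc : maximal g x ≤ c) :
    ∫⁻ y in Metric.ball x r, kernel ρ (x - y) * g y ≤
      (2 ^ n * C * ballVol n * N : ℝ≥0) *
        (c * ∫⁻ t in Ioo 0 (k * 2 ^ N * r), ENNReal.ofReal (ρ t / t)) := by
  have hk := hρ.1
  have h1 := setLIntegral_kernel_le hn hρ hg x hr (σ := fun j => -(j : ℤ))
    (fun a b h => by simpa using h) (ball_subset_iUnion_annulus x hr)
    (F := fun _ => ballVol n * c) (G := fun _ => c) (A := ballVol n) (S := Ioo 0 (k * 2 ^ N * r))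
    (fun j => by
      have : 0 < r * 2 ^ (-(j : ℤ)) := by positivity
      refine (setLIntegral_ball_le_maximal g x this).trans ?_
      rw [volume_ball x this, mul_assoc]
      gcongr) (fun _ _ _ _ _ => le_rfl) (fun j t ht => by
      refine ⟨lt_of_lt_of_le (by positivity) ht.1, ht.2.trans_le ?_⟩
      calc k * r * 2 ^ (-(j : ℤ)) * 2 ^ N ≤ k * r * 1 * 2 ^ N := by
            gcongr
            exact zpow_le_one_of_nonpos₀ one_le_two (by omega)
        _ = _ := by ring)
  rwa [lintegral_mul_const' _ _ hc, mul_comm (∫⁻ t in _, _) c] at h1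

/-- The far part, for a general doubling majorant F of the averages: F = Φ⁻¹(t⁻ⁿ) in Hedberg's
inequality and F = φ₁ in the Morrey estimate. -/
theorem setLIntegral_compl_ball_kernel_le (hn : 1 ≤ n) {C : ℝ≥0} {k : ℝ} {N : ℕ}
    (hρ : SupBound ρ C k N) {F : ℝ → ℝ≥0∞} (hF : IsDoubling F) :
    ∃ K : ℝ≥0, ∀ (c : ℝ≥0∞) (g : E n → ℝ≥0∞) (x : E n) (r : ℝ), AEMeasurable g → 0 < r → c ≠ ⊤ →
      (∀ R, 0 < R → ∫⁻ y in Metric.ball x R, g y ≤ c * (ENNReal.ofReal (R ^ n) * F R)) →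
      ∫⁻ y in (Metric.ball x r)ᶜ, kernel ρ (x - y) * g y ≤
        K * (c * ∫⁻ t in Ioi (k * r), ENNReal.ofReal (ρ t / t) * F t) := by
  have hk := hρ.1
  obtain ⟨A, -, hA⟩ := hF k (k * 2 ^ N) hk (by positivity)
  refine ⟨2 ^ n * C * A * N, fun c g x r hg hr hc h => ?_⟩
  have h1 := setLIntegral_kernel_le hn hρ hg x hr (σ := fun j => (j : ℤ) + 1)
    (fun a b h => by simpa using h) (compl_ball_subset_iUnion_annulus x hr)
    (F := fun t => c * F t) (G := fun t => c * F t) (A := A) (S := Ioi (k * r))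
    (fun j => by
      have : 0 < r * 2 ^ ((j : ℤ) + 1) := by positivity
      exact (h _ this).trans_eq (by ring))
    (fun R t hR h1 h2 => by
      rw [mul_left_comm]
      gcongr
      exact hA R t hR ((by positivity : 0 < k * R).trans_le h1) h1 h2)
    (fun j t ht => by
      refine lt_of_lt_of_le ?_ ht.1
      exact lt_mul_of_one_lt_right (by positivity) (one_lt_zpow₀ one_lt_two (by omega)))
  simp only [mul_left_comm _ c] at h1
  rwa [lintegral_const_mul' _ _ hc] at h1

end Kernel

/-! ### Hedberg's inequality and Orlicz bounds for I_ρ -/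

section Hedberg

variable {n : ℕ} {ρ : ℝ → ℝ} {Φ Ψ : ℝ≥0∞ → ℝ≥0∞}

theorem potential_const_mul {c : ℝ≥0∞} (hc : c ≠ ⊤) (g : E n → ℝ≥0∞) (x : E n) :
    potential ρ (fun y => c * g y) x = c * potential ρ g x := by
  simp only [potential, mul_left_comm _ c]
  rw [lintegral_const_mul' _ _ hc]

theorem exists_ofReal_inv_pow_eq (hn : 1 ≤ n) {s : ℝ≥0∞} (hs0 : 0 < s) (hs : s ≠ ⊤) :
    ∃ r : ℝ, 0 < r ∧ ENNReal.ofReal ((r ^ n)⁻¹) = s := by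
  have h1 : 0 < s.toReal := ENNReal.toReal_pos hs0.ne' hs
  refine ⟨(s.toReal⁻¹) ^ ((n : ℝ)⁻¹), by positivity, ?_⟩
  rw [Real.rpow_inv_natCast_pow (by positivity) (by omega), inv_inv, ENNReal.ofReal_toReal hs]

/-- Hedberg's pointwise inequality, in modular form. -/
theorem exists_map_potential_le (hn : 1 ≤ n) (hΦ : IsYoung Φ) (hΨ : IsYoung Ψ)
    (hsup : SupCond ρ) (hcond : OrliczCond n ρ Φ Ψ) :
    ∃ C : ℝ≥0, 0 < C ∧ ∀ g : E n → ℝ≥0∞, AEMeasurable g → ∫⁻ x, Φ (g x) ≤ 1 →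
      ∀ x, Ψ (potential ρ g x / C) ≤ Φ (maximal g x) := by
  obtain ⟨C, k, N, hρ⟩ := hsup.exists_supBound
  obtain ⟨C₀, hcond⟩ := hcond
  have hk := hρ.1
  obtain ⟨A₁, -, hA₁⟩ := isDoubling_invPow (n := n) hΦ (k * 2 ^ N) (k * 2 ^ N)
    (by positivity) (by positivity)
  obtain ⟨A₂, -, hA₂⟩ := isDoubling_invPow (n := n) hΨ (k * 2 ^ N)⁻¹ (k * 2 ^ N)⁻¹
    (by positivity) (by positivity)
  obtain ⟨A₃, -, hA₃⟩ := isDoubling_invPow (n := n) hΨ k⁻¹ k⁻¹ (by positivity) (by positivity)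
  obtain ⟨K, hK⟩ := setLIntegral_compl_ball_kernel_le hn hρ (isDoubling_invPow (n := n) hΦ)
  set K₁ : ℝ≥0 := 2 ^ n * C * ballVol n * N
  set c : ℝ≥0 := 2 * ballConst n * ballVol n
  -- The near constant plus the far constant; the final 1 only ensures positivity.
  refine ⟨K₁ * (A₁ * (C₀ * A₂)) + K * (c * (C₀ * A₃)) + 1, by positivity,
    fun g hg hg1 x => ?_⟩
  refine le_of_forall_gt_imp_ge_of_dense fun s hs => ?_
  rcases eq_or_ne s ⊤ with rfl | hst
  · exact le_top
  have hs0 : 0 < s := zero_le.trans_lt hs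
  -- The balancing radius: Mg(x) ≤ Φ⁻¹(r⁻ⁿ), while the goal reads I_ρ g(x)/C ≤ Ψ⁻¹(r⁻ⁿ).
  obtain ⟨r, hr, hrs⟩ := exists_ofReal_inv_pow_eq hn hs0 hst
  rw [← hΨ.le_youngInv_iff, ← hrs]
  change _ ≤ invPow n Ψ r
  have hM : maximal g x ≤ invPow n Φ r := hΦ.le_youngInv (hrs ▸ hs.le)
  have hnear : ∫⁻ y in Metric.ball x r, kernel ρ (x - y) * g y ≤
      K₁ * (A₁ * (C₀ * A₂)) * invPow n Ψ r := by
    refine (setLIntegral_ball_kernel_le hn hρ hg x hr (invPow_lt_top hΦ r).ne hM).trans ?_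
    rw [mul_assoc (K₁ : ℝ≥0∞)]
    refine mul_le_mul_right ?_ _
    have hr' : 0 < k * 2 ^ N * r := by positivity
    calc _ ≤ A₁ * invPow n Φ (k * 2 ^ N * r) *
          ∫⁻ t in Ioo 0 (k * 2 ^ N * r), ENNReal.ofReal (ρ t / t) := by
          gcongr
          exact hA₁ r _ hr hr' le_rfl le_rfl
      _ ≤ A₁ * (C₀ * invPow n Ψ (k * 2 ^ N * r)) := by
          rw [mul_assoc (A₁ : ℝ≥0∞)]
          exact mul_le_mul_right (le_self_add.trans (hcond _ hr')) _
      _ ≤ A₁ * (C₀ * (A₂ * invPow n Ψ r)) := by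
          gcongr
          exact hA₂ _ r hr' hr (inv_mul_cancel_left₀ (by positivity) _).le
            (inv_mul_cancel_left₀ (by positivity) _).ge
      _ = _ := by ring
  have hfar : ∫⁻ y in (Metric.ball x r)ᶜ, kernel ρ (x - y) * g y ≤
      K * (c * (C₀ * A₃)) * invPow n Ψ r := by
    refine (hK c g x r hg hr ENNReal.coe_ne_top fun R hR =>
      setLIntegral_ball_le_of_modular hΦ x hR ((setLIntegral_le_lintegral _ _).trans hg1)).trans ?_
    rw [mul_assoc (K : ℝ≥0∞), mul_assoc (c : ℝ≥0∞)]
    refine mul_le_mul_right (mul_le_mul_right ?_ _) _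
    have hr' : 0 < k * r := by positivity
    calc _ ≤ C₀ * invPow n Ψ (k * r) := le_add_self.trans (hcond _ hr')
      _ ≤ C₀ * (A₃ * invPow n Ψ r) := by
          gcongr
          exact hA₃ _ r hr' hr (inv_mul_cancel_left₀ (by positivity) _).le
            (inv_mul_cancel_left₀ (by positivity) _).ge
      _ = _ := by ring
  refine ENNReal.div_le_of_le_mul ?_
  rw [potential, ← lintegral_add_compl _ (Metric.isOpen_ball (x := x) (ε := r)).measurableSet]
  refine (add_le_add hnear hfar).trans ?_
  rw [← add_mul, mul_comm]
  push_cast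
  exact mul_le_mul_right le_self_add _

/-- Modular weak type inequality for the generalized fractional integral. -/
theorem exists_map_mul_volume_potential_le (hn : 1 ≤ n) (hΦ : IsYoung Φ) (hΨ : IsYoung Ψ)
    (hsup : SupCond ρ) (hcond : OrliczCond n ρ Φ Ψ) :
    ∃ C : ℝ≥0, 0 < C ∧ ∀ g : E n → ℝ≥0∞, AEMeasurable g → ∫⁻ x, Φ (g x) ≤ 1 →
      ∀ l, Ψ (l / C) * volume {x | l < potential ρ g x} ≤ 1 := by
  obtain ⟨C, hC, h⟩ := exists_map_potential_le hn hΦ hΨ hsup hcond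
  -- The 2 is from Jensen for M(g/2); 4ⁿ is the weak (1,1) constant, absorbed through convexity of
  -- Ψ.
  refine ⟨2 * C * 4 ^ n, by positivity, fun g hg hg1 l => ?_⟩
  set A := {x | l < potential ρ g x} with hA
  have hhalf : ∀ y, g y / 2 = 2⁻¹ * g y := fun y => ENNReal.div_eq_inv_mul
  have hpt : ∀ x, Ψ (potential ρ g x / (2 * C)) ≤ maximal (fun y => Φ (g y)) x := by
    intro x
    have h1 := h (fun y => g y / 2) (hg.div_const 2) (by
      refine le_trans (lintegral_mono fun y => hΦ.mono ?_) hg1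
      exact ENNReal.half_le_self) x
    refine le_trans (le_of_eq ?_) (h1.trans (map_maximal_half_le hΦ g x))
    simp only [hhalf]
    rw [potential_const_mul (by simp), div_eq_mul_inv, ENNReal.mul_inv (by simp) (by simp),
      div_eq_mul_inv]
    congr 1
    ring
  have hmain : Ψ (l / (2 * C)) * volume A ≤ 4 ^ n := by
    rcases eq_or_ne (volume A) 0 with h0 | h0
    · simp [h0]
    have h4t : (4 ^ n : ℝ≥0∞) ≠ ⊤ := by simp
    have h40 : (4 ^ n : ℝ≥0∞) ≠ 0 := by simp
    rw [← ENNReal.le_div_iff_mul_le (Or.inl h0) (Or.inr h4t)]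
    -- On A only Ψ(l/(2C)) ≤ M(Φ∘g) is known, so a smaller s is needed to enter the strict
    -- superlevel set.
    refine le_of_forall_lt_imp_le_of_dense fun s hs => ?_
    rw [ENNReal.le_div_iff_mul_le (Or.inl h0) (Or.inr h4t)]
    calc s * volume A ≤ s * volume {x | s < maximal (fun y => Φ (g y)) x} := by
          gcongr
          intro x hx
          refine hs.trans_le (le_trans (hΨ.mono ?_) (hpt x))
          gcongr
          exact le_of_lt hx
      _ ≤ 4 ^ n * ∫⁻ x, Φ (g x) := mul_volume_lt_maximal_le hn _ s
      _ ≤ 4 ^ n * 1 := by gcongr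
      _ = 4 ^ n := mul_one _
  have e1 : l / (2 * C * 4 ^ n : ℝ≥0) = ((4 ^ n)⁻¹ : ℝ≥0) * (l / (2 * C)) := by
    push_cast
    rw [div_eq_mul_inv, div_eq_mul_inv, ENNReal.mul_inv (by simp) (by simp)]
    ring
  rw [e1]
  have h41 : ((4 ^ n)⁻¹ : ℝ≥0) ≤ 1 := inv_le_one_of_one_le₀ (one_le_pow₀ (by norm_num))
  calc _ ≤ ((4 ^ n)⁻¹ : ℝ≥0) * Ψ (l / (2 * C)) * volume A := by
        gcongr
        exact hΨ.map_mul_le h41 _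
    _ ≤ ((4 ^ n)⁻¹ : ℝ≥0) * 4 ^ n := by
        rw [mul_assoc]
        gcongr
    _ = 1 := by
        rw [ENNReal.coe_inv (by positivity)]
        push_cast
        exact ENNReal.inv_mul_cancel (by simp) (by simp)

/-- Modular strong type inequality for the generalized fractional integral. -/
theorem exists_lintegral_map_potential_le (hn : 1 ≤ n) (hΦ : IsYoung Φ) (hΨ : IsYoung Ψ)
    (hsup : SupCond ρ) (hcond : OrliczCond n ρ Φ Ψ) (h2 : Nabla2 Φ) :
    ∃ C : ℝ≥0, 0 < C ∧ ∀ g : E n → ℝ≥0∞, AEMeasurable g → ∫⁻ x, Φ (g x) ≤ 1 →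
      ∫⁻ x, Ψ (potential ρ g x / C) ≤ 1 := by
  obtain ⟨C, hC, h⟩ := exists_map_potential_le hn hΦ hΨ hsup hcond
  obtain ⟨c, hc, hc1, hmax⟩ := exists_lintegral_map_maximal_le_one hn hΦ h2
  refine ⟨C / c, by positivity, fun g hg hg1 => ?_⟩
  refine le_trans (lintegral_mono fun x => ?_) (hmax g hg hg1)
  refine le_trans (le_of_eq ?_) (h (fun y => c * g y) (hg.const_mul _) ?_ x)
  · rw [potential_const_mul ENNReal.coe_ne_top, ENNReal.coe_div hc.ne', div_eq_mul_inv,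
      div_eq_mul_inv, div_eq_mul_inv, ENNReal.mul_inv (Or.inl (by simpa using hC.ne')) (by simp), inv_inv]
    congr 1
    ring
  · refine le_trans (lintegral_mono fun y => hΦ.mono ?_) hg1
    exact mul_le_of_le_one_left' (by exact_mod_cast hc1)

variable {C : ℝ≥0}

/-- The set lies in every superlevel set of finite height, and Ψ is unbounded on finite arguments.
This yields absolute convergence almost everywhere. -/
theorem volume_potential_eq_top (hΨ : IsYoung Ψ) (hC : 0 < C) {g : E n → ℝ≥0∞}
    (h : ∀ l, Ψ (l / C) * volume {x | l < potential ρ g x} ≤ 1) :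
    volume {x | potential ρ g x = ⊤} = 0 := by
  by_contra h0
  obtain ⟨u, hut, hu⟩ := hΨ.exists_lt_map
    (ENNReal.inv_lt_top.2 (pos_iff_ne_zero.2 h0))
  have hC0 : (C : ℝ≥0∞) ≠ 0 := by simpa using hC.ne'
  have h1 := h (u * C)
  rw [ENNReal.mul_div_cancel_right hC0 ENNReal.coe_ne_top] at h1
  have h2 : Ψ u * volume {x | potential ρ g x = ⊤} ≤ 1 := by
    refine le_trans (mul_le_mul_right (measure_mono fun x hx => ?_) _) h1
    rw [mem_ofPred_eq] at hx ⊢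
    rw [hx]
    exact ENNReal.mul_lt_top hut ENNReal.coe_lt_top
  have h3 : Ψ u ≤ (volume {x | potential ρ g x = ⊤})⁻¹ := by
    rw [← one_div, ENNReal.le_div_iff_mul_le (Or.inl h0) (Or.inr ENNReal.one_ne_top)]
    exact h2
  exact absurd hu (not_lt.2 h3)

theorem map_mul_volume_ball_le_one (hΨ : IsYoung Ψ) (x : E n) {r : ℝ} (hr : 0 < r) {u : ℝ≥0∞}
    (hu : ballConst n * u ≤ invPow n Ψ r) : Ψ u * volume (Metric.ball x r) ≤ 1 := by
  have hK0 : (ballConst n : ℝ≥0∞) ≠ 0 := by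
    simpa using (zero_lt_one.trans_le one_le_ballConst).ne'
  have h1 : u ≤ youngInv Ψ (volume (Metric.ball x r))⁻¹ := by
    have h2 := hu.trans (invPow_le_youngInv_inv_volume hΨ x hr)
    rwa [ENNReal.mul_le_mul_iff_right hK0 ENNReal.coe_ne_top] at h2
  refine (mul_le_mul_left (hΨ.le_youngInv_iff.1 h1) _).trans_eq ?_
  exact ENNReal.inv_mul_cancel (volume_ball_pos x hr).ne' measure_ball_lt_top.ne

/-- Two ranges of the level m. If m ≤ 2c, the norm of the constant m on the whole ball is small
enough. If m > 2c, then P > m forces the potential above m/2, and the modular weak bound applies at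
level m/(2l). -/
theorem luxNorm_weak_le_of_local (hΨ : IsYoung Ψ) (hC : 0 < C) {g P : E n → ℝ≥0∞} {x₀ : E n}
    {r : ℝ} (hr : 0 < r) {l c : ℝ≥0∞} (hl0 : 0 < l) (hlt : l < ⊤)
    (h : ∀ m, Ψ (m / C) * volume {x | m < potential ρ (fun y => l⁻¹ * g y) x} ≤ 1)
    (hP : ∀ x ∈ Metric.ball x₀ r, P x ≤ potential ρ g x + c) (hc : c ≤ l * invPow n Ψ r)
    (m : ℝ≥0∞) :
    luxNorm Ψ ((Metric.ball x₀ r ∩ {x | m < P x}).indicator fun _ => m) ≤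
      (2 * (C + ballConst n) : ℝ≥0) * l := by
  have hK : 0 < C + ballConst n := by positivity
  have hC0 : (C : ℝ≥0∞) ≠ 0 := by simpa using hC.ne'
  set M : ℝ≥0∞ := (2 * (C + ballConst n) : ℝ≥0) * l with hM
  have hM0 : M ≠ 0 := mul_ne_zero (by exact_mod_cast (mul_pos two_pos hK).ne') hl0.ne'
  have hMt : M ≠ ⊤ := ENNReal.mul_ne_top ENNReal.coe_ne_top hlt.ne
  refine luxNorm_le (pos_iff_ne_zero.2 hM0) (lt_top_iff_ne_top.2 hMt) ?_
  rcases le_or_gt m (2 * c) with hmc | hmc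
  · refine (lintegral_indicator_const_le hΨ Metric.isOpen_ball.measurableSet
      inter_subset_left _ _).trans (map_mul_volume_ball_le_one hΨ x₀ hr ?_)
    rw [← mul_div_assoc]
    refine ENNReal.div_le_of_le_mul ?_
    calc ballConst n * m ≤ ballConst n * (2 * (l * invPow n Ψ r)) := by gcongr; exact hmc.trans (by gcongr)
      _ = invPow n Ψ r * ((2 * (0 + ballConst n) : ℝ≥0) * l) := by push_cast; ring
      _ ≤ invPow n Ψ r * M := by
        rw [hM]
        gcongr
  · set A := toMeasurable volume {x | m / (2 * l) < potential ρ (fun y => l⁻¹ * g y) x}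
    have hsub : Metric.ball x₀ r ∩ {x | m < P x} ⊆ A := by
      refine Subset.trans (fun x hx => ?_) (subset_toMeasurable _ _)
      have h1 : m < potential ρ g x + c := lt_of_lt_of_le hx.2 (hP x hx.1)
      have h2 : m / 2 < potential ρ g x := by
        by_contra! h3
        have h4 : c ≤ m / 2 := by
          rw [ENNReal.le_div_iff_mul_le (by simp) (by simp), mul_comm]
          exact hmc.le
        have h5 := h1.trans_le (add_le_add h3 h4)
        rw [ENNReal.add_halves] at h5
        exact lt_irrefl _ h5
      rw [mem_ofPred_eq, potential_const_mul (ENNReal.inv_ne_top.2 hl0.ne'), mul_comm l⁻¹,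
        ← div_eq_mul_inv]
      rw [ENNReal.lt_div_iff_mul_lt (Or.inl hl0.ne') (Or.inl hlt.ne)]
      refine lt_of_eq_of_lt ?_ h2
      rw [div_eq_mul_inv, ENNReal.mul_inv (by simp) (by simp), div_eq_mul_inv, mul_assoc,
        mul_assoc, ENNReal.inv_mul_cancel hl0.ne' hlt.ne, mul_one]
    refine (lintegral_indicator_const_le hΨ (measurableSet_toMeasurable _ _) hsub _ _).trans ?_
    rw [measure_toMeasurable]
    refine le_trans ?_ (h (m / (2 * l)))
    gcongr
    refine hΨ.mono ?_
    rw [div_eq_mul_inv (m / (2 * l)), div_eq_mul_inv m (2 * l), mul_assoc,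
      ← ENNReal.mul_inv (Or.inr ENNReal.coe_ne_top) (Or.inr hC0), ← div_eq_mul_inv]
    gcongr
    rw [hM]
    calc 2 * l * (C : ℝ≥0∞) = (2 * (C + 0) : ℝ≥0) * l := by push_cast; ring
      _ ≤ _ := by gcongr; exact zero_le

/-- Midpoint convexity splits Ψ(P/M) into halves of a potential term and a constant term, each of
integral at most 1 over the ball; this dictates the factor 2(C + `ballConst n`). -/
theorem luxNorm_le_of_local (hΨ : IsYoung Ψ) (hC : 0 < C) {g P : E n → ℝ≥0∞} {x₀ : E n}
    {r : ℝ} (hr : 0 < r) {l c : ℝ≥0∞} (hl0 : 0 < l) (hlt : l < ⊤)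
    (h : ∫⁻ x, Ψ (potential ρ (fun y => l⁻¹ * g y) x / C) ≤ 1)
    (hP : ∀ x ∈ Metric.ball x₀ r, P x ≤ potential ρ g x + c) (hc : c ≤ l * invPow n Ψ r) :
    luxNorm Ψ ((Metric.ball x₀ r).indicator P) ≤ (2 * (C + ballConst n) : ℝ≥0) * l := by
  have hK : 0 < C + ballConst n := by positivity
  have hb : 0 < ballConst n := zero_lt_one.trans_le one_le_ballConst
  have hb0 : (ballConst n : ℝ≥0∞) ≠ 0 := by simpa using hb.ne'
  set M : ℝ≥0∞ := (2 * (C + ballConst n) : ℝ≥0) * l with hM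
  have hM0 : M ≠ 0 := mul_ne_zero (by exact_mod_cast (mul_pos two_pos hK).ne') hl0.ne'
  have hMt : M ≠ ⊤ := ENNReal.mul_ne_top ENNReal.coe_ne_top hlt.ne
  refine luxNorm_le (pos_iff_ne_zero.2 hM0) (lt_top_iff_ne_top.2 hMt) ?_
  have hmB : MeasurableSet (Metric.ball x₀ r) := Metric.isOpen_ball.measurableSet
  have e1 : ∀ x, Ψ ((Metric.ball x₀ r).indicator P x / M) =
      (Metric.ball x₀ r).indicator (fun x => Ψ (P x / M)) x := by
    intro x
    by_cases hx : x ∈ Metric.ball x₀ r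
    · simp only [indicator_of_mem hx]
    · simp only [indicator_of_notMem hx, ENNReal.zero_div, hΨ.map_zero]
  simp only [e1]
  rw [lintegral_indicator hmB]
  have hpt : ∀ x ∈ Metric.ball x₀ r, Ψ (P x / M) ≤
      Ψ (potential ρ (fun y => l⁻¹ * g y) x / C) / 2 + Ψ (c / (l * ballConst n)) / 2 := by
    intro x hx
    refine le_trans (hΨ.mono ?_) (hΨ.map_half_add_half _ _)
    have h1 : P x / M ≤ potential ρ g x / M + c / M := by
      rw [← ENNReal.add_div]
      exact ENNReal.div_le_div_right (hP x hx) _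
    refine h1.trans (add_le_add ?_ ?_)
    · rw [potential_const_mul (ENNReal.inv_ne_top.2 hl0.ne'), ← ENNReal.div_eq_inv_mul]
      have e3 : potential ρ g x / l / C / 2 = potential ρ g x / (2 * C * l) := by
        simp only [div_eq_mul_inv]
        rw [ENNReal.mul_inv (Or.inr hlt.ne) (Or.inr hl0.ne'), ENNReal.mul_inv (by simp) (by simp)]
        ring
      rw [e3, hM]
      refine ENNReal.div_le_div_left ?_ _
      push_cast
      gcongr
      exact le_self_add
    · have e3 : c / (l * ballConst n) / 2 = c / (2 * ballConst n * l) := by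
        simp only [div_eq_mul_inv]
        rw [ENNReal.mul_inv (Or.inr hlt.ne) (Or.inr hl0.ne'),
          ENNReal.mul_inv (by simp) (by simp [hb.ne']), ENNReal.mul_inv (by simp) (by simp)]
        ring
      rw [e3, hM]
      refine ENNReal.div_le_div_left ?_ _
      push_cast
      gcongr
      exact le_add_self
  calc ∫⁻ x in Metric.ball x₀ r, Ψ (P x / M)
      ≤ ∫⁻ x in Metric.ball x₀ r, (Ψ (potential ρ (fun y => l⁻¹ * g y) x / C) / 2 +
          Ψ (c / (l * ballConst n)) / 2) := setLIntegral_mono' hmB hpt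
    _ = (∫⁻ x in Metric.ball x₀ r, Ψ (potential ρ (fun y => l⁻¹ * g y) x / C)) / 2 +
          Ψ (c / (l * ballConst n)) * volume (Metric.ball x₀ r) / 2 := by
        rw [lintegral_add_right _ measurable_const, setLIntegral_const]
        simp only [div_eq_mul_inv]
        rw [lintegral_mul_const' _ _ (by simp)]
        congr 1
        ring
    _ ≤ 1 / 2 + 1 / 2 := by
        gcongr
        · exact (setLIntegral_le_lintegral _ _).trans h
        · refine map_mul_volume_ball_le_one hΨ x₀ hr ?_
          rw [← mul_div_assoc]
          refine ENNReal.div_le_of_le_mul ?_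
          calc ballConst n * c ≤ ballConst n * (l * invPow n Ψ r) := by gcongr
            _ = _ := by ring
    _ = 1 := by rw [ENNReal.add_halves]

end Hedberg

/-! ### Polar coordinates and measurability of I_ρ f -/

section Polar

variable {n : ℕ}

/-- Integration in polar coordinates of a radial function. -/
theorem lintegral_fun_norm (hn : 1 ≤ n) {g : ℝ → ℝ≥0∞} (hg : Measurable g) :
    ∫⁻ y : E n, g ‖y‖ = (n * ballVol n : ℝ≥0) *
      ∫⁻ t in Ioi (0 : ℝ), ENNReal.ofReal (t ^ (n - 1)) * g t := by
  have := nontrivial_of_one_le hn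
  have hgm : Measurable fun p : Metric.sphere (0 : E n) 1 × Ioi (0 : ℝ) => g p.2 :=
    hg.comp (measurable_subtype_coe.comp measurable_snd)
  calc ∫⁻ y : E n, g ‖y‖
      = ∫⁻ y : ({(0)}ᶜ : Set (E n)), g ‖y.1‖ ∂(volume.comap Subtype.val) := by
        rw [lintegral_subtype_comap (measurableSet_singleton _).compl fun y : E n => g ‖y‖,
          restrict_compl_singleton]
    _ = ∫⁻ p, g p.2 ∂(volume : Measure (E n)).toSphere.prod (.volumeIoiPow (n - 1)) := by
        have h := (volume : Measure (E n)).measurePreserving_homeomorphUnitSphereProd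
        rw [finrank_euclideanSpace_fin] at h
        rw [← h.lintegral_comp hgm]
        simp
    _ = ∫⁻ _ : Metric.sphere (0 : E n) 1, (∫⁻ t : Ioi (0 : ℝ), g t ∂.volumeIoiPow (n - 1))
          ∂(volume : Measure (E n)).toSphere := lintegral_prod _ hgm.aemeasurable
    _ = (∫⁻ t : Ioi (0 : ℝ), g t ∂.volumeIoiPow (n - 1)) *
          (volume : Measure (E n)).toSphere univ := lintegral_const _
    _ = _ := by
        rw [Measure.toSphere_apply_univ, finrank_euclideanSpace_fin, ← coe_ballVol,
          Measure.volumeIoiPow, lintegral_withDensity_eq_lintegral_mul₀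
            (by fun_prop) (show AEMeasurable (fun t : Ioi (0 : ℝ) => g t) _ from
              (hg.comp measurable_subtype_coe).aemeasurable), mul_comm]
        congr 1
        exact lintegral_subtype_comap measurableSet_Ioi
          fun t => ENNReal.ofReal (t ^ (n - 1)) * g t

/-- Null sets of radii give null sets of points. Since ρ is only Lebesgue measurable, this permits
passing to a Borel representative inside the kernel. -/
theorem ae_norm_sub (hn : 1 ≤ n) {p : ℝ → Prop} (hp : ∀ᵐ t ∂volume.restrict (Ioi 0), p t)
    (x : E n) : ∀ᵐ y : E n, p ‖x - y‖ := by
  have := nontrivial_of_one_le hn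
  have h0 : (volume.restrict (Ioi (0 : ℝ))) {t | ¬ p t} = 0 := hp
  set N := toMeasurable (volume.restrict (Ioi (0 : ℝ))) {t | ¬ p t} with hN
  have hNm : MeasurableSet N := measurableSet_toMeasurable _ _
  have hN0 : (volume.restrict (Ioi (0 : ℝ))) N = 0 := by rw [hN, measure_toMeasurable, h0]
  have h1 : ∫⁻ y : E n, N.indicator 1 ‖y‖ = 0 := by
    rw [lintegral_fun_norm hn (measurable_one.indicator hNm)]
    have : ∫⁻ t in Ioi (0 : ℝ), ENNReal.ofReal (t ^ (n - 1)) * N.indicator 1 t = 0 := by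
      rw [lintegral_eq_zero_iff (by
        exact Measurable.mul (by fun_prop) (measurable_one.indicator hNm))]
      filter_upwards [measure_eq_zero_iff_ae_notMem.1 hN0] with t ht
      simp [ht]
    rw [this, mul_zero]
  have h2 : ∀ᵐ y : E n, ‖y‖ ∉ N := by
    rw [lintegral_eq_zero_iff (show Measurable fun y : E n => N.indicator 1 ‖y‖ from
      (measurable_one.indicator hNm).comp measurable_norm)] at h1
    filter_upwards [h1] with y hy hyN
    simp [hyN] at hy
  have h3 := (Measure.measurePreserving_sub_left (volume : Measure (E n)) x).quasiMeasurePreserving.ae h2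
  filter_upwards [h3] with y hy
  by_contra hpy
  exact hy (subset_toMeasurable _ _ hpy)

variable {𝕜 : Type*} [RCLike 𝕜] {ρ : ℝ → ℝ}

theorem ae_kernel_eq (hn : 1 ≤ n) (hρ : AEMeasurable ρ (volume.restrict (Ioi 0)))
    (f : E n → 𝕜) (hf : AEStronglyMeasurable f) (x : E n) :
    (fun y : E n => (ρ ‖x - y‖ / ‖x - y‖ ^ n) • f y) =ᵐ[volume]
      fun y => (hρ.mk ρ ‖x - y‖ / ‖x - y‖ ^ n) • hf.mk f y := by
  filter_upwards [ae_norm_sub hn hρ.ae_eq_mk x, hf.ae_eq_mk] with y h1 h2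
  rw [h1, h2]

theorem stronglyMeasurable_kernel_smul {ρ : ℝ → ℝ} (hρ : Measurable ρ) {f : E n → 𝕜}
    (hf : StronglyMeasurable f) :
    StronglyMeasurable (fun p : E n × E n => (ρ ‖p.1 - p.2‖ / ‖p.1 - p.2‖ ^ n) • f p.2) := by
  have h1 : Measurable fun p : E n × E n => ‖p.1 - p.2‖ :=
    (measurable_fst.sub measurable_snd).norm
  exact ((hρ.comp h1).div (h1.pow_const n)).stronglyMeasurable.smul
    (hf.comp_measurable measurable_snd)

theorem aestronglyMeasurable_kernel_smul (hn : 1 ≤ n)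
    (hρ : AEMeasurable ρ (volume.restrict (Ioi 0))) {f : E n → 𝕜} (hf : AEStronglyMeasurable f)
    (x : E n) : AEStronglyMeasurable fun y : E n => (ρ ‖x - y‖ / ‖x - y‖ ^ n) • f y :=
  ((stronglyMeasurable_kernel_smul hρ.measurable_mk hf.stronglyMeasurable_mk).comp_measurable
    measurable_prodMk_left).aestronglyMeasurable.congr (ae_kernel_eq hn hρ f hf x).symm

theorem aestronglyMeasurable_fracInt (hn : 1 ≤ n)
    (hρ : AEMeasurable ρ (volume.restrict (Ioi 0))) {f : E n → 𝕜} (hf : AEStronglyMeasurable f) :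
    AEStronglyMeasurable (fracInt ρ f) := by
  have : fracInt ρ f = fun x => ∫ y, (hρ.mk ρ ‖x - y‖ / ‖x - y‖ ^ n) • hf.mk f y :=
    funext fun x => integral_congr_ae (ae_kernel_eq hn hρ f hf x)
  rw [this]
  exact (StronglyMeasurable.integral_prod_right' (stronglyMeasurable_kernel_smul
    hρ.measurable_mk hf.stronglyMeasurable_mk)).aestronglyMeasurable

/-- At y = x the quotient is a division by 0ⁿ = 0, hence 0, and the uncontrolled value ρ(0) plays no
role. -/
theorem enorm_kernel_smul (hn : 1 ≤ n) (hρ : PosMeas ρ) (f : E n → 𝕜) (x y : E n) :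
    ‖(ρ ‖x - y‖ / ‖x - y‖ ^ n) • f y‖ₑ = kernel ρ (x - y) * ‖f y‖ₑ := by
  have : 0 ≤ ρ ‖x - y‖ / ‖x - y‖ ^ n := by
    rcases (norm_nonneg (x - y)).eq_or_lt with h | h
    · rw [← h, zero_pow (by omega), div_zero]
    · have := (hρ.2 _ h).le
      positivity
  rw [enorm_smul, Real.enorm_of_nonneg this, kernel]

theorem enorm_fracInt_le (hn : 1 ≤ n) (hρ : PosMeas ρ) (f : E n → 𝕜) (x : E n) :
    ‖fracInt ρ f x‖ₑ ≤ potential ρ (fun y => ‖f y‖ₑ) x := by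
  refine (enorm_integral_le_lintegral_enorm _).trans_eq ?_
  simp only [enorm_kernel_smul hn hρ]
  rfl

theorem integrable_kernel_smul (hn : 1 ≤ n) (hρ : PosMeas ρ) {f : E n → 𝕜}
    (hf : AEStronglyMeasurable f) {x : E n} (h : potential ρ (fun y => ‖f y‖ₑ) x < ⊤) :
    Integrable fun y : E n => (ρ ‖x - y‖ / ‖x - y‖ ^ n) • f y := by
  refine ⟨aestronglyMeasurable_kernel_smul hn hρ.1 hf x, ?_⟩
  rw [hasFiniteIntegral_iff_enorm]
  simp only [enorm_kernel_smul hn hρ]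
  exact h

end Polar

/-! ### Membership criteria and embeddings of Morrey spaces -/

section Embeddings

variable {𝕜 : Type*} [RCLike 𝕜] {n : ℕ} {Φ Ψ : ℝ≥0∞ → ℝ≥0∞} {φ φ₁ φ₂ ρ : ℝ → ℝ}

theorem orliczNorm_indicator (s : Set (E n)) (f : E n → 𝕜) :
    orliczNorm Φ (s.indicator f) = luxNorm Φ (s.indicator fun x => ‖f x‖ₑ) := by
  simp only [orliczNorm, enorm_indicator_eq_indicator_enorm]

theorem invPow_mul_le_morreyNorm (hφ : ∀ t, 0 < t → 0 < φ t) (f : E n → 𝕜) (x : E n) {r : ℝ}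
    (hr : 0 < r) : invPow n Φ r * luxNorm Φ ((Metric.ball x r).indicator fun x => ‖f x‖ₑ) ≤
      morreyNorm Φ φ f * ENNReal.ofReal (φ r) := by
  have h1 : (ENNReal.ofReal (φ r))⁻¹ * invPow n Φ r * orliczNorm Φ ((Metric.ball x r).indicator f)
      ≤ morreyNorm Φ φ f :=
    le_iSup_of_le x (le_iSup₂_of_le r hr le_rfl)
  rw [orliczNorm_indicator, mul_assoc, ← ENNReal.div_eq_inv_mul,
    ENNReal.div_le_iff_le_mul (Or.inl (ENNReal.ofReal_pos.2 (hφ r hr)).ne')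
      (Or.inl ENNReal.ofReal_ne_top)] at h1
  exact h1

theorem inv_mul_mul_le {a b Q K : ℝ≥0∞} (ha0 : a ≠ 0) (ha : a ≠ ⊤) (hb0 : b ≠ 0) (hb : b ≠ ⊤)
    {D : ℝ≥0∞} (hQ : Q ≤ K * (D * (a / b))) : a⁻¹ * b * Q ≤ K * D := by
  calc a⁻¹ * b * Q ≤ a⁻¹ * b * (K * (D * (a / b))) := by gcongr
    _ = K * D * (a⁻¹ * a) * (b⁻¹ * b) := by rw [div_eq_mul_inv]; ring
    _ = K * D := by rw [ENNReal.inv_mul_cancel ha0 ha, ENNReal.inv_mul_cancel hb0 hb, mul_one, mul_one]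

theorem memOrlicz_indicator_ball (hΦ : IsYoung Φ) {f : E n → 𝕜} (hf : AEStronglyMeasurable f)
    (x : E n) {r : ℝ} (hr : 0 < r) (h : orliczNorm Φ ((Metric.ball x r).indicator f) < ⊤) :
    MemOrlicz Φ ((Metric.ball x r).indicator f) := by
  have hm : MeasurableSet (Metric.ball x r) := Metric.isOpen_ball.measurableSet
  constructor
  · refine Integrable.locallyIntegrable ⟨hf.indicator hm, ?_⟩
    rw [hasFiniteIntegral_iff_enorm]
    simp only [enorm_indicator_eq_indicator_enorm]
    rw [lintegral_indicator hm]
    refine (setLIntegral_ball_le_luxNorm hΦ x hr _).trans_lt ?_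
    rw [orliczNorm_indicator] at h
    exact ENNReal.mul_lt_top (ENNReal.mul_lt_top ENNReal.coe_lt_top
      (ENNReal.mul_lt_top ENNReal.ofReal_lt_top (invPow_lt_top hΦ r))) h
  · obtain ⟨l, ⟨hl0, hlt, hl⟩, -⟩ := sInf_lt_iff.1 h
    have hlt' : l⁻¹ ≠ ⊤ := ENNReal.inv_ne_top.2 hl0.ne'
    refine ⟨l⁻¹.toNNReal, ENNReal.toNNReal_pos (ENNReal.inv_ne_zero.2 hlt.ne) hlt', ?_⟩
    rw [ENNReal.coe_toNNReal hlt']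
    simp only [← ENNReal.div_eq_inv_mul]
    exact hl.trans_lt ENNReal.one_lt_top

theorem orliczNorm_lt_top_of_morreyNorm (hΦ : IsYoung Φ) (hφ : ∀ t, 0 < t → 0 < φ t)
    {f : E n → 𝕜} (h : morreyNorm Φ φ f < ⊤) (x : E n) {r : ℝ} (hr : 0 < r) :
    orliczNorm Φ ((Metric.ball x r).indicator f) < ⊤ := by
  rw [orliczNorm_indicator]
  refine lt_top_iff_ne_top.2 fun htop => ?_
  have h1 := invPow_mul_le_morreyNorm (Φ := Φ) hφ f x hr
  rw [htop, ENNReal.mul_top (invPow_pos hΦ hr).ne'] at h1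
  exact absurd h1 (not_le.2 (ENNReal.mul_lt_top h ENNReal.ofReal_lt_top))

theorem memMorrey_of_morreyNorm (hΦ : IsYoung Φ) (hφ : ∀ t, 0 < t → 0 < φ t) {f : E n → 𝕜}
    (hf : AEStronglyMeasurable f) (h : morreyNorm Φ φ f < ⊤) : MemMorrey Φ φ f :=
  ⟨⟨hf, fun x _ hr => memOrlicz_indicator_ball hΦ hf x hr
    (orliczNorm_lt_top_of_morreyNorm hΦ hφ h x hr)⟩, h⟩

theorem memWeakMorrey_of_weakMorreyNorm (hΦ : IsYoung Φ) {f : E n → 𝕜}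
    (hf : AEStronglyMeasurable f) (h : weakMorreyNorm Φ φ f < ⊤) : MemWeakMorrey Φ φ f := by
  refine ⟨⟨hf, fun x r hr => ?_⟩, h⟩
  refine lt_top_iff_ne_top.2 fun htop => ?_
  have h1 : (ENNReal.ofReal (φ r))⁻¹ * invPow n Φ r *
      weakOrliczNorm Φ ((Metric.ball x r).indicator f) ≤ weakMorreyNorm Φ φ f :=
    le_iSup_of_le x (le_iSup₂_of_le r hr le_rfl)
  rw [htop, ENNReal.mul_top (mul_ne_zero (ENNReal.inv_ne_zero.2 ENNReal.ofReal_ne_top)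
    (invPow_pos hΦ hr).ne')] at h1
  exact absurd h1 (not_le.2 h)

theorem weakOrliczNorm_le_orliczNorm (hΦ : IsYoung Φ) (f : E n → 𝕜) :
    weakOrliczNorm Φ f ≤ orliczNorm Φ f := by
  refine iSup₂_le fun l _ => luxNorm_mono hΦ fun x => ?_
  exact indicator_apply_le' (fun hx => le_of_lt hx) (fun _ => zero_le)

theorem weakMorreyNorm_le_morreyNorm (hΦ : IsYoung Φ) (f : E n → 𝕜) :
    weakMorreyNorm Φ φ f ≤ morreyNorm Φ φ f := by
  refine iSup_mono fun x => iSup₂_mono fun r _ => ?_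
  gcongr
  exact weakOrliczNorm_le_orliczNorm hΦ _

theorem BoundedStrong.boundedWeak (hΨ : IsYoung Ψ) (h : BoundedStrong 𝕜 n ρ Φ φ₁ Ψ φ₂) :
    BoundedWeak 𝕜 n ρ Φ φ₁ Ψ φ₂ := by
  obtain ⟨C, h⟩ := h
  refine ⟨C, fun f hf => ?_⟩
  obtain ⟨h1, h2, h3⟩ := h f hf
  have h4 := weakMorreyNorm_le_morreyNorm (φ := φ₂) hΨ (fracInt ρ f)
  exact ⟨h1, memWeakMorrey_of_weakMorreyNorm hΨ h2.1.1 (h4.trans_lt h2.2), h4.trans h3⟩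

theorem youngInv_id (s : ℝ≥0∞) : youngInv (fun t => t) s = s :=
  le_antisymm (IsYoung.id.map_youngInv_le s) (IsYoung.id.le_youngInv le_rfl)

theorem luxNorm_id_le (g : E n → ℝ≥0∞) : luxNorm (fun t => t) g ≤ ∫⁻ x, g x := by
  refine le_of_forall_gt fun l hl => ?_
  obtain ⟨m, hm, hml⟩ := exists_between hl
  have hm0 : 0 < m := zero_le.trans_lt hm
  have hmt : m < ⊤ := hml.trans_le le_top
  refine (luxNorm_le hm0 hmt ?_).trans_lt hml
  simp only [div_eq_mul_inv]
  rw [lintegral_mul_const' _ _ (ENNReal.inv_ne_top.2 hm0.ne'), ← div_eq_mul_inv]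
  exact ENNReal.div_le_of_le_mul (by simpa using hm.le)

/-- On a ball of radius r, Jensen compares L¹ with L^Ψ at the cost rⁿ Ψ⁻¹(r⁻ⁿ), exactly the ratio of
the two normalizing factors. -/
theorem weakMorreyNorm_id_le (hΨ : IsYoung Ψ) (f : E n → 𝕜) :
    weakMorreyNorm (fun t => t) φ f ≤
      (2 * ballConst n * ballVol n : ℝ≥0) * weakMorreyNorm Ψ φ f := by
  refine iSup_le fun x => iSup₂_le fun r hr => ?_
  set B := Metric.ball x r with hB
  set K : ℝ≥0 := 2 * ballConst n * ballVol n
  have hr0 : ENNReal.ofReal (r ^ n) ≠ 0 := (ENNReal.ofReal_pos.2 (by positivity)).ne'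
  have h1 : weakOrliczNorm (fun t => t) (B.indicator f) ≤
      K * (ENNReal.ofReal (r ^ n) * invPow n Ψ r) * weakOrliczNorm Ψ (B.indicator f) := by
    refine iSup₂_le fun l hl => ?_
    set g := ({x | (l : ℝ≥0∞) < ‖B.indicator f x‖ₑ}.indicator fun _ => (l : ℝ≥0∞)) with hg
    have hgB : B.indicator g = g := by
      refine indicator_eq_self.2 fun y hy => ?_
      by_contra hyB
      refine hy ?_
      simp [hg, hyB]
    calc luxNorm (fun t => t) g ≤ ∫⁻ y, g y := luxNorm_id_le g
      _ = ∫⁻ y in B, g y := by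
        rw [← lintegral_indicator Metric.isOpen_ball.measurableSet, hgB]
      _ ≤ K * (ENNReal.ofReal (r ^ n) * invPow n Ψ r) * luxNorm Ψ (B.indicator g) :=
        setLIntegral_ball_le_luxNorm hΨ x hr g
      _ ≤ _ := by
        rw [hgB]
        gcongr
        exact le_iSup₂ (f := fun (l : ℝ≥0) (_ : 0 < l) => luxNorm Ψ
          ({x | (l : ℝ≥0∞) < ‖B.indicator f x‖ₑ}.indicator fun _ => (l : ℝ≥0∞))) l hl
  have h2 : invPow n (fun t => t) r = (ENNReal.ofReal (r ^ n))⁻¹ := by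
    rw [invPow, youngInv_id, ENNReal.ofReal_inv_of_pos (by positivity)]
  rw [h2]
  calc _ ≤ (ENNReal.ofReal (φ r))⁻¹ * (ENNReal.ofReal (r ^ n))⁻¹ *
        (K * (ENNReal.ofReal (r ^ n) * invPow n Ψ r) * weakOrliczNorm Ψ (B.indicator f)) := by
        gcongr
    _ = K * ((ENNReal.ofReal (r ^ n))⁻¹ * ENNReal.ofReal (r ^ n)) *
        ((ENNReal.ofReal (φ r))⁻¹ * invPow n Ψ r * weakOrliczNorm Ψ (B.indicator f)) := by ring
    _ ≤ K * weakMorreyNorm Ψ φ f := by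
        rw [ENNReal.inv_mul_cancel hr0 ENNReal.ofReal_ne_top, mul_one]
        gcongr
        exact le_iSup_of_le x (le_iSup₂_of_le r hr le_rfl)

theorem BoundedWeak.boundedWeak_id (hΨ : IsYoung Ψ) (h : BoundedWeak 𝕜 n ρ Φ φ₁ Ψ φ₂) :
    BoundedWeak 𝕜 n ρ Φ φ₁ (fun t => t) φ₂ := by
  obtain ⟨C, h⟩ := h
  refine ⟨2 * ballConst n * ballVol n * C, fun f hf => ?_⟩
  obtain ⟨h1, h2, h3⟩ := h f hf
  have h4 := weakMorreyNorm_id_le (φ := φ₂) hΨ (fracInt ρ f)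
  refine ⟨h1, memWeakMorrey_of_weakMorreyNorm IsYoung.id h2.1.1
    (h4.trans_lt (ENNReal.mul_lt_top ENNReal.coe_lt_top h2.2)), h4.trans ?_⟩
  rw [ENNReal.coe_mul _ C, mul_assoc (_ : ℝ≥0∞)]
  exact mul_le_mul_right h3 _

end Embeddings

/-! ### Sufficiency: local and far parts -/

section Sufficiency

variable {𝕜 : Type*} [RCLike 𝕜] {n : ℕ} {Φ Ψ : ℝ≥0∞ → ℝ≥0∞} {φ₁ φ₂ ρ : ℝ → ℝ}

theorem potential_le_add_of_mem_ball {g : E n → ℝ≥0∞} {x₀ x : E n} {r : ℝ}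
    (hx : x ∈ Metric.ball x₀ r) :
    potential ρ g x ≤ potential ρ ((Metric.ball x₀ (2 * r)).indicator g) x +
      ∫⁻ y in (Metric.ball x r)ᶜ, kernel ρ (x - y) * g y := by
  have hm : MeasurableSet (Metric.ball x₀ (2 * r)) := Metric.isOpen_ball.measurableSet
  rw [potential, ← lintegral_add_compl _ hm]
  refine add_le_add (le_of_eq ?_) (lintegral_mono_set (compl_subset_compl.2 ?_))
  · rw [potential, ← lintegral_indicator hm]
    refine lintegral_congr fun y => ?_
    by_cases hy : y ∈ Metric.ball x₀ (2 * r) <;> simp [hy]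
  · refine Metric.ball_subset_ball' ?_
    have := Metric.mem_ball.1 hx
    linarith

/-- The only place where the Morrey conditions are used: `RatioCond` at radius 2r for the local
norm, `TailCond` at radius kr for the far part, with doubling of φ₂/Ψ⁻¹ and φ₂ to return to r. D
stands for the Morrey norm. -/
theorem exists_local_bounds (hn : 1 ≤ n) (hΦ : IsYoung Φ) (hΨ : IsYoung Ψ)
    (hφ₁ : ClassG n Φ φ₁) (hφ₂ : ClassG n Ψ φ₂) (hsup : SupCond ρ)
    (hratio : RatioCond n Φ Ψ φ₁ φ₂) (htail : TailCond ρ φ₁ φ₂) :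
    ∃ K : ℝ≥0, ∀ (g : E n → ℝ≥0∞) (D : ℝ≥0∞), AEMeasurable g → D ≠ ⊤ →
      (∀ (x : E n) (r : ℝ), 0 < r →
        invPow n Φ r * luxNorm Φ ((Metric.ball x r).indicator g) ≤ D * ENNReal.ofReal (φ₁ r)) →
      ∀ (x₀ : E n) (r : ℝ), 0 < r →
        luxNorm Φ ((Metric.ball x₀ (2 * r)).indicator g) ≤
            K * (D * (ENNReal.ofReal (φ₂ r) / invPow n Ψ r)) ∧
          ∀ x ∈ Metric.ball x₀ r, potential ρ g x ≤
            potential ρ ((Metric.ball x₀ (2 * r)).indicator g) x +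
              K * (D * ENNReal.ofReal (φ₂ r)) := by
  obtain ⟨C, k, N, hρ⟩ := hsup.exists_supBound
  have hk := hρ.1
  obtain ⟨C₁, hratio⟩ := hratio
  obtain ⟨C₂, htail⟩ := htail
  obtain ⟨A₁, -, hA₁⟩ := hφ₂.isDoubling_div (1 / 2) (1 / 2) (by norm_num) (by norm_num)
  obtain ⟨A₂, -, hA₂⟩ := hφ₂.isDoubling hΨ k⁻¹ k⁻¹ (by positivity) (by positivity)
  obtain ⟨K, hK⟩ := setLIntegral_compl_ball_kernel_le hn hρ (hφ₁.isDoubling hΦ)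
  set c : ℝ≥0 := 2 * ballConst n * ballVol n
  refine ⟨max (C₁ * A₁) (K * (c * (C₂ * A₂))), fun g D hg hD h x₀ r hr => ⟨?_, fun x hx => ?_⟩⟩
  · have hr2 : 0 < 2 * r := by positivity
    have hi0 := (invPow_pos (n := n) hΦ hr2).ne'
    have hit := (invPow_lt_top (n := n) hΦ (2 * r)).ne
    calc luxNorm Φ ((Metric.ball x₀ (2 * r)).indicator g)
        ≤ D * (ENNReal.ofReal (φ₁ (2 * r)) / invPow n Φ (2 * r)) := by
          rw [← mul_div_assoc, ENNReal.le_div_iff_mul_le (Or.inl hi0) (Or.inl hit), mul_comm]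
          exact h x₀ _ hr2
      _ ≤ D * (C₁ * (A₁ * (ENNReal.ofReal (φ₂ r) / invPow n Ψ r))) := by
          refine mul_le_mul_right ((hratio _ hr2).trans (mul_le_mul_right ?_ _)) _
          exact hA₁ (2 * r) r hr2 hr (by linarith) (by linarith)
      _ = (C₁ * A₁ : ℝ≥0) * (D * (ENNReal.ofReal (φ₂ r) / invPow n Ψ r)) := by push_cast; ring
      _ ≤ _ := by
          gcongr
          exact le_max_left _ _
  · refine (potential_le_add_of_mem_ball hx).trans (add_le_add_right ?_ _)
    have hkr : 0 < k * r := by positivity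
    have h1 := hK (c * D) g x r hg hr (ENNReal.mul_ne_top ENNReal.coe_ne_top hD) fun R hR => by
      calc ∫⁻ y in Metric.ball x R, g y
          ≤ c * (ENNReal.ofReal (R ^ n) * invPow n Φ R) *
            luxNorm Φ ((Metric.ball x R).indicator g) := setLIntegral_ball_le_luxNorm hΦ x hR g
        _ = c * ENNReal.ofReal (R ^ n) *
            (invPow n Φ R * luxNorm Φ ((Metric.ball x R).indicator g)) := by ring
        _ ≤ c * ENNReal.ofReal (R ^ n) * (D * ENNReal.ofReal (φ₁ R)) := by
            exact mul_le_mul_right (h x R hR) _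
        _ = _ := by ring
    have h2 : ∫⁻ t in Ioi (k * r), ENNReal.ofReal (ρ t / t) * ENNReal.ofReal (φ₁ t) ≤
        C₂ * (A₂ * ENNReal.ofReal (φ₂ r)) := by
      calc _ = ∫⁻ t in Ioi (k * r), ENNReal.ofReal (φ₁ t * ρ t / t) := by
            refine setLIntegral_congr_fun measurableSet_Ioi fun t ht => ?_
            have := (hφ₁.1.2 t (hkr.trans ht)).le
            rw [← ENNReal.ofReal_mul' this]
            congr 1
            ring
        _ ≤ C₂ * ENNReal.ofReal (φ₂ (k * r)) := htail _ hkr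
        _ ≤ _ := mul_le_mul_right (hA₂ _ r hkr hr (inv_mul_cancel_left₀ hk.ne' _).le
            (inv_mul_cancel_left₀ hk.ne' _).ge) _
    calc _ ≤ _ := h1
      _ ≤ K * (c * D * (C₂ * (A₂ * ENNReal.ofReal (φ₂ r)))) := by gcongr
      _ = (K * (c * (C₂ * A₂)) : ℝ≥0) * (D * ENNReal.ofReal (φ₂ r)) := by push_cast; ring
      _ ≤ _ := by
          gcongr
          exact le_max_right _ _

/-- The modular at l is known to be at most 1 only for l strictly above the Luxemburg norm. Working
with l > Q also covers Q = 0. -/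
theorem le_mul_of_forall_lt {a K Q : ℝ≥0∞} (hK0 : K ≠ 0) (hK : K ≠ ⊤)
    (h : ∀ l, Q < l → l < ⊤ → a ≤ K * l) : a ≤ K * Q := by
  have h1 : a / K ≤ Q := le_of_forall_gt_imp_ge_of_dense fun l hl => by
    rcases eq_or_ne l ⊤ with rfl | hlt
    · exact le_top
    · exact ENNReal.div_le_of_le_mul ((h l hl (lt_top_iff_ne_top.2 hlt)).trans_eq (mul_comm _ _))
  rw [ENNReal.div_le_iff_le_mul (Or.inl hK0) (Or.inl hK)] at h1
  exact h1.trans_eq (mul_comm _ _)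

theorem div_mul_invPow_cancel (hΨ : IsYoung Ψ) (K D a : ℝ≥0∞) {r : ℝ} (hr : 0 < r) :
    K * (D * a) = K * (D * (a / invPow n Ψ r)) * invPow n Ψ r := by
  rw [mul_assoc, mul_assoc, ENNReal.div_mul_cancel (invPow_pos hΨ hr).ne' (invPow_lt_top hΨ r).ne]

theorem lintegral_map_inv_mul_le_one (hΦ : IsYoung Φ) {g : E n → ℝ≥0∞} {l : ℝ≥0∞}
    (h : luxNorm Φ g < l) : ∫⁻ x, Φ (l⁻¹ * g x) ≤ 1 := by
  simpa only [ENNReal.div_eq_inv_mul] using lintegral_le_one_of_luxNorm_lt hΦ h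

theorem boundedWeak_of_conditions (hn : 1 ≤ n) (hΦ : IsYoung Φ) (hΨ : IsYoung Ψ)
    (hφ₁ : ClassG n Φ φ₁) (hφ₂ : ClassG n Ψ φ₂) (hρ : PosMeas ρ) (hsup : SupCond ρ)
    (hcond : OrliczCond n ρ Φ Ψ) (hratio : RatioCond n Φ Ψ φ₁ φ₂) (htail : TailCond ρ φ₁ φ₂) :
    BoundedWeak 𝕜 n ρ Φ φ₁ Ψ φ₂ := by
  obtain ⟨K, hK⟩ := exists_local_bounds hn hΦ hΨ hφ₁ hφ₂ hsup hratio htail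
  obtain ⟨C, hC, hweak⟩ := exists_map_mul_volume_potential_le hn hΦ hΨ hsup hcond
  have hC' : 0 < 2 * (C + ballConst n) := by positivity
  refine ⟨2 * (C + ballConst n) * K, fun f hf => ?_⟩
  set g : E n → ℝ≥0∞ := fun x => ‖f x‖ₑ with hg
  have hgm : AEMeasurable g := hf.1.1.enorm
  set D := morreyNorm Φ φ₁ f with hD
  have hDt : D ≠ ⊤ := hf.2.ne
  have hloc := hK g D hgm hDt fun x r hr => invPow_mul_le_morreyNorm hφ₁.1.2 f x hr
  have hest : ∀ (x₀ : E n) (r : ℝ), 0 < r → ∀ l,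
      K * (D * (ENNReal.ofReal (φ₂ r) / invPow n Ψ r)) < l → l < ⊤ →
      ∀ m, Ψ (m / C) * volume {x | m < potential ρ
        (fun y => l⁻¹ * (Metric.ball x₀ (2 * r)).indicator g y) x} ≤ 1 := by
    intro x₀ r hr l hl hlt m
    exact hweak _ ((hgm.indicator Metric.isOpen_ball.measurableSet).const_mul _)
      (lintegral_map_inv_mul_le_one hΦ ((hloc x₀ r hr).1.trans_lt hl)) m
  have hQt : ∀ r, 0 < r → K * (D * (ENNReal.ofReal (φ₂ r) / invPow n Ψ r)) ≠ ⊤ := fun r hr =>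
    ENNReal.mul_ne_top ENNReal.coe_ne_top (ENNReal.mul_ne_top hDt
      (ENNReal.div_lt_top ENNReal.ofReal_ne_top (invPow_pos hΨ hr).ne').ne)
  -- On each ball B(0, N+1) the local potential is finite almost everywhere by the weak bound and
  -- the far part is bounded; these balls exhaust the space.
  have hdef : FracIntDefined ρ f := by
    have h1 : ∀ N : ℕ, ∀ᵐ x : E n, x ∈ Metric.ball (0 : E n) (N + 1) → potential ρ g x < ⊤ := by
      intro N
      have hN : (0 : ℝ) < N + 1 := by positivity
      obtain ⟨l, hl, hlt⟩ := exists_between (lt_top_iff_ne_top.2 (hQt _ hN))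
      have hl0 : l ≠ 0 := (zero_le.trans_lt hl).ne'
      have h2 := volume_potential_eq_top hΨ hC (hest 0 _ hN l hl hlt)
      filter_upwards [measure_eq_zero_iff_ae_notMem.1 h2] with x hx hxB
      refine ((hloc 0 _ hN).2 x hxB).trans_lt (ENNReal.add_lt_top.2 ⟨?_, ?_⟩)
      · rw [potential_const_mul (ENNReal.inv_ne_top.2 hl0)] at hx
        refine lt_top_iff_ne_top.2 fun htop => hx ?_
        rw [htop, ENNReal.mul_top (ENNReal.inv_ne_zero.2 hlt.ne)]
      · exact ENNReal.mul_lt_top ENNReal.coe_lt_top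
          (ENNReal.mul_lt_top (lt_top_iff_ne_top.2 hDt) ENNReal.ofReal_lt_top)
    filter_upwards [ae_all_iff.2 h1] with x hx
    obtain ⟨N, hN⟩ := exists_nat_gt ‖x‖
    exact integrable_kernel_smul hn hρ hf.1.1 (hx N (by simpa using hN.trans (lt_add_one _)))
  have hnorm : weakMorreyNorm Ψ φ₂ (fracInt ρ f) ≤ (2 * (C + ballConst n) * K : ℝ≥0) * D := by
    refine iSup_le fun x₀ => iSup₂_le fun r hr => ?_
    refine inv_mul_mul_le (hφ₂.pos hr).ne' ENNReal.ofReal_ne_top (invPow_pos hΨ hr).ne'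
      (invPow_lt_top hΨ r).ne (iSup₂_le fun m hm => ?_)
    rw [ENNReal.coe_mul _ K, mul_assoc]
    refine le_mul_of_forall_lt (by exact_mod_cast hC'.ne') ENNReal.coe_ne_top fun l hl hlt => ?_
    refine le_trans (luxNorm_mono hΨ ?_) (luxNorm_weak_le_of_local hΨ hC hr
      (zero_le.trans_lt hl) hlt (hest x₀ r hr l hl hlt) (hloc x₀ r hr).2 ?_ m)
    · refine indicator_le_indicator_of_subset (fun x hx => ?_) (fun _ => zero_le)
      rw [mem_ofPred_eq, enorm_indicator_eq_indicator_enorm] at hx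
      by_cases hxB : x ∈ Metric.ball x₀ r
      · rw [indicator_of_mem hxB] at hx
        exact ⟨hxB, hx.trans_le (enorm_fracInt_le hn hρ f x)⟩
      · simp [hxB] at hx
    · rw [div_mul_invPow_cancel hΨ _ _ _ hr]
      gcongr
  exact ⟨hdef, memWeakMorrey_of_weakMorreyNorm hΨ (aestronglyMeasurable_fracInt hn hρ.1 hf.1.1)
    (hnorm.trans_lt (ENNReal.mul_lt_top ENNReal.coe_lt_top (lt_top_iff_ne_top.2 hDt))), hnorm⟩

theorem boundedStrong_of_conditions (hn : 1 ≤ n) (hΦ : IsYoung Φ) (hΨ : IsYoung Ψ)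
    (hφ₁ : ClassG n Φ φ₁) (hφ₂ : ClassG n Ψ φ₂) (hρ : PosMeas ρ) (hsup : SupCond ρ)
    (hcond : OrliczCond n ρ Φ Ψ) (hratio : RatioCond n Φ Ψ φ₁ φ₂) (htail : TailCond ρ φ₁ φ₂)
    (h2 : Nabla2 Φ) : BoundedStrong 𝕜 n ρ Φ φ₁ Ψ φ₂ := by
  obtain ⟨K, hK⟩ := exists_local_bounds hn hΦ hΨ hφ₁ hφ₂ hsup hratio htail
  obtain ⟨C, hC, hstrong⟩ := exists_lintegral_map_potential_le hn hΦ hΨ hsup hcond h2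
  -- The weak result serves here only to supply absolute convergence almost everywhere.
  obtain ⟨_, hw⟩ := boundedWeak_of_conditions (𝕜 := 𝕜) hn hΦ hΨ hφ₁ hφ₂ hρ hsup hcond hratio htail
  have hC' : 0 < 2 * (C + ballConst n) := by positivity
  refine ⟨2 * (C + ballConst n) * K, fun f hf => ?_⟩
  set g : E n → ℝ≥0∞ := fun x => ‖f x‖ₑ with hg
  have hgm : AEMeasurable g := hf.1.1.enorm
  set D := morreyNorm Φ φ₁ f with hD
  have hDt : D ≠ ⊤ := hf.2.ne
  have hloc := hK g D hgm hDt fun x r hr => invPow_mul_le_morreyNorm hφ₁.1.2 f x hr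
  have hnorm : morreyNorm Ψ φ₂ (fracInt ρ f) ≤ (2 * (C + ballConst n) * K : ℝ≥0) * D := by
    refine iSup_le fun x₀ => iSup₂_le fun r hr => ?_
    refine inv_mul_mul_le (hφ₂.pos hr).ne' ENNReal.ofReal_ne_top (invPow_pos hΨ hr).ne'
      (invPow_lt_top hΨ r).ne ?_
    rw [ENNReal.coe_mul _ K, mul_assoc, orliczNorm_indicator]
    refine le_mul_of_forall_lt (by exact_mod_cast hC'.ne') ENNReal.coe_ne_top fun l hl hlt => ?_
    refine luxNorm_le_of_local hΨ hC hr (zero_le.trans_lt hl) hlt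
      (hstrong _ ((hgm.indicator Metric.isOpen_ball.measurableSet).const_mul _)
        (lintegral_map_inv_mul_le_one hΦ ((hloc x₀ r hr).1.trans_lt hl)))
      (fun x hx => (enorm_fracInt_le hn hρ f x).trans ((hloc x₀ r hr).2 x hx)) ?_
    rw [div_mul_invPow_cancel hΨ _ _ _ hr]
    gcongr
  exact ⟨(hw f hf).1, memMorrey_of_morreyNorm hΨ hφ₂.1.2
    (aestronglyMeasurable_fracInt hn hρ.1 hf.1.1)
    (hnorm.trans_lt (ENNReal.mul_lt_top ENNReal.coe_lt_top (lt_top_iff_ne_top.2 hDt))), hnorm⟩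

end Sufficiency

/-! ### Necessity: testing on characteristic functions of balls -/

section Necessity

variable {𝕜 : Type*} [RCLike 𝕜] {n : ℕ} {Φ Ψ : ℝ≥0∞ → ℝ≥0∞} {φ₁ φ₂ ρ : ℝ → ℝ}

/-- Integration in polar coordinates of a radial function around a point. -/
theorem lintegral_fun_norm_sub (hn : 1 ≤ n) {g : ℝ → ℝ≥0∞}
    (hg : AEMeasurable g (volume.restrict (Ioi 0))) (x : E n) :
    ∫⁻ y : E n, g ‖x - y‖ = (n * ballVol n : ℝ≥0) *
      ∫⁻ t in Ioi (0 : ℝ), ENNReal.ofReal (t ^ (n - 1)) * g t := by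
  calc ∫⁻ y : E n, g ‖x - y‖ = ∫⁻ y : E n, hg.mk g ‖x - y‖ :=
        lintegral_congr_ae (ae_norm_sub hn hg.ae_eq_mk x)
    _ = ∫⁻ y : E n, hg.mk g ‖y‖ := lintegral_sub_left_eq_self (fun y : E n => hg.mk g ‖y‖) x
    _ = _ := by
        rw [lintegral_fun_norm hn hg.measurable_mk]
        congr 1
        refine lintegral_congr_ae ?_
        filter_upwards [hg.ae_eq_mk] with t ht
        rw [ht]

theorem setLIntegral_ball_kernel (hn : 1 ≤ n) (hρ : AEMeasurable ρ (volume.restrict (Ioi 0)))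
    (x : E n) (r : ℝ) :
    ∫⁻ y in Metric.ball x r, kernel ρ (x - y) =
      (n * ballVol n : ℝ≥0) * ∫⁻ t in Ioo 0 r, ENNReal.ofReal (ρ t / t) := by
  have hg : AEMeasurable ((Iio r).indicator fun t => ENNReal.ofReal (ρ t / t ^ n))
      (volume.restrict (Ioi 0)) :=
    ((hρ.div (by fun_prop)).ennreal_ofReal).indicator measurableSet_Iio
  have h1 := lintegral_fun_norm_sub hn hg x
  rw [← lintegral_indicator Metric.isOpen_ball.measurableSet]
  refine Eq.trans (lintegral_congr fun y => ?_) (h1.trans ?_)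
  · by_cases hy : ‖x - y‖ < r
    · have : y ∈ Metric.ball x r := by rwa [Metric.mem_ball, dist_comm, dist_eq_norm]
      simp [this, hy, kernel]
    · have : y ∉ Metric.ball x r := by rwa [Metric.mem_ball, dist_comm, dist_eq_norm]
      simp [this, hy]
  · congr 1
    rw [← Iio_inter_Ioi, ← Measure.restrict_restrict measurableSet_Iio,
      ← lintegral_indicator measurableSet_Iio]
    refine setLIntegral_congr_fun measurableSet_Ioi fun t (ht : 0 < t) => ?_
    by_cases htr : t < r
    · simp only [indicator_of_mem (show t ∈ Iio r from htr)]
      rw [← ENNReal.ofReal_mul (by positivity)]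
      congr 1
      have : t ^ n = t ^ (n - 1) * t := by rw [← pow_succ]; congr 1; omega
      rw [this]
      field_simp
    · simp only [indicator_of_notMem (show t ∉ Iio r from htr), mul_zero]

/-- The characteristic function of the ball `B(0,r)`. -/
noncomputable def ballChar (𝕜 : Type*) [RCLike 𝕜] (n : ℕ) (r : ℝ) : E n → 𝕜 :=
  (Metric.ball (0 : E n) r).indicator fun _ => 1

theorem stronglyMeasurable_ballChar (r : ℝ) : StronglyMeasurable (ballChar 𝕜 n r) :=
  stronglyMeasurable_const.indicator Metric.isOpen_ball.measurableSet

/-- For test balls of radius s ≤ r the quantity is ≲ 1/φ₁(s), and φ₁ is almost decreasing. For s ≥ r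
it is ≲ Φ⁻¹(s⁻ⁿ)/(φ₁(s) Φ⁻¹(r⁻ⁿ)), and φ₁/Φ⁻¹ is almost increasing. -/
theorem exists_morreyNorm_ballChar_le (hΦ : IsYoung Φ) (hφ₁ : ClassG n Φ φ₁)
    (hdec : AlmostDecreasing fun t => ENNReal.ofReal (φ₁ t)) :
    ∃ K : ℝ≥0, ∀ r : ℝ, 0 < r →
      morreyNorm Φ φ₁ (ballChar 𝕜 n r) ≤ K * (ENNReal.ofReal (φ₁ r))⁻¹ := by
  obtain ⟨-, ⟨C₁, hC₁, h₁⟩, -⟩ := id hφ₁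
  obtain ⟨C₂, hC₂, h₂⟩ := hdec
  refine ⟨ballConst n * (C₁ + C₂⁻¹), fun r hr => iSup_le fun x => iSup₂_le fun s hs => ?_⟩
  have hp : ∀ t, 0 < t → ENNReal.ofReal (φ₁ t) ≠ 0 := fun t ht => (hφ₁.pos ht).ne'
  have hi0 : ∀ t, 0 < t → invPow n Φ t ≠ 0 := fun t ht => (invPow_pos hΦ ht).ne'
  have hit : ∀ t, invPow n Φ t ≠ ⊤ := fun t => (invPow_lt_top hΦ t).ne
  have hnorm : orliczNorm Φ ((Metric.ball x s).indicator (ballChar 𝕜 n r)) =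
      luxNorm Φ ((Metric.ball x s ∩ Metric.ball 0 r).indicator fun _ => 1) := by
    rw [orliczNorm_indicator, ← indicator_indicator]
    congr 2
    ext y
    rw [ballChar, enorm_indicator_eq_indicator_enorm]
    simp
  rw [hnorm]
  rcases le_total s r with hsr | hrs
  · have h3 := luxNorm_indicator_const_le hΦ (x := x) hs
      (inter_subset_left : Metric.ball x s ∩ Metric.ball 0 r ⊆ _) (c := 1) ENNReal.one_ne_top
    have h4 : (ENNReal.ofReal (φ₁ s))⁻¹ ≤ (C₂⁻¹ : ℝ≥0) * (ENNReal.ofReal (φ₁ r))⁻¹ := by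
      rw [ENNReal.coe_inv hC₂.ne', ← ENNReal.mul_inv (Or.inr ENNReal.ofReal_ne_top)
        (Or.inl ENNReal.coe_ne_top)]
      exact ENNReal.inv_le_inv.2 (h₂ s r hs hsr)
    calc _ ≤ (ENNReal.ofReal (φ₁ s))⁻¹ * invPow n Φ s * (ballConst n * 1 / invPow n Φ s) := by
          gcongr
      _ = (ENNReal.ofReal (φ₁ s))⁻¹ * ballConst n * ((invPow n Φ s)⁻¹ * invPow n Φ s) := by
          rw [div_eq_mul_inv]; ring
      _ ≤ (C₂⁻¹ : ℝ≥0) * (ENNReal.ofReal (φ₁ r))⁻¹ * ballConst n := by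
          rw [ENNReal.inv_mul_cancel (hi0 s hs) (hit s), mul_one]
          gcongr
      _ = (ballConst n * (0 + C₂⁻¹) : ℝ≥0) * (ENNReal.ofReal (φ₁ r))⁻¹ := by
          rw [zero_add, ENNReal.coe_mul]; ring
      _ ≤ _ := by
          gcongr
  · have h3 := luxNorm_indicator_const_le hΦ (x := 0) hr
      (inter_subset_right : Metric.ball x s ∩ Metric.ball 0 r ⊆ _) (c := 1) ENNReal.one_ne_top
    have h4 : (ENNReal.ofReal (φ₁ s))⁻¹ * invPow n Φ s ≤
        C₁ * ((ENNReal.ofReal (φ₁ r))⁻¹ * invPow n Φ r) := by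
      have h5 := h₁ r s hr hrs
      rw [ENNReal.div_le_iff_le_mul (Or.inl (hi0 r hr)) (Or.inl (hit r))] at h5
      calc (ENNReal.ofReal (φ₁ s))⁻¹ * invPow n Φ s
          = (ENNReal.ofReal (φ₁ s))⁻¹ * invPow n Φ s *
            ((ENNReal.ofReal (φ₁ r))⁻¹ * ENNReal.ofReal (φ₁ r)) := by
            rw [ENNReal.inv_mul_cancel (hp r hr) ENNReal.ofReal_ne_top, mul_one]
        _ ≤ (ENNReal.ofReal (φ₁ s))⁻¹ * invPow n Φ s * ((ENNReal.ofReal (φ₁ r))⁻¹ *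
            (C₁ * (ENNReal.ofReal (φ₁ s) / invPow n Φ s) * invPow n Φ r)) := by gcongr
        _ = C₁ * ((ENNReal.ofReal (φ₁ r))⁻¹ * invPow n Φ r) *
            ((ENNReal.ofReal (φ₁ s))⁻¹ * ENNReal.ofReal (φ₁ s)) *
            ((invPow n Φ s)⁻¹ * invPow n Φ s) := by rw [div_eq_mul_inv]; ring
        _ = _ := by
            rw [ENNReal.inv_mul_cancel (hp s hs) ENNReal.ofReal_ne_top,
              ENNReal.inv_mul_cancel (hi0 s hs) (hit s), mul_one, mul_one]
    calc _ ≤ C₁ * ((ENNReal.ofReal (φ₁ r))⁻¹ * invPow n Φ r) *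
          (ballConst n * 1 / invPow n Φ r) := mul_le_mul' h4 h3
      _ = C₁ * (ENNReal.ofReal (φ₁ r))⁻¹ * ballConst n * ((invPow n Φ r)⁻¹ * invPow n Φ r) := by
          rw [div_eq_mul_inv]; ring
      _ = (ballConst n * (C₁ + 0) : ℝ≥0) * (ENNReal.ofReal (φ₁ r))⁻¹ := by
          rw [ENNReal.inv_mul_cancel (hi0 r hr) (hit r), add_zero, ENNReal.coe_mul]; ring
      _ ≤ _ := by
          gcongr
          exact zero_le

/-- The integrand is nonnegative, so nothing cancels. Integrability is essential, since the Bochner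
integral would otherwise be 0. -/
theorem enorm_fracInt_ballChar (hn : 1 ≤ n) (hρ : PosMeas ρ) (r : ℝ) {x : E n}
    (hx : Integrable fun y : E n => (ρ ‖x - y‖ / ‖x - y‖ ^ n) • ballChar 𝕜 n r y) :
    ‖fracInt ρ (ballChar 𝕜 n r) x‖ₑ = ∫⁻ y in Metric.ball 0 r, kernel ρ (x - y) := by
  set h : E n → ℝ := fun y => ‖(ρ ‖x - y‖ / ‖x - y‖ ^ n) • ballChar 𝕜 n r y‖ with hh
  have hk : ∀ y : E n, 0 ≤ ρ ‖x - y‖ / ‖x - y‖ ^ n := by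
    intro y
    rcases (norm_nonneg (x - y)).eq_or_lt with h | h
    · rw [← h, zero_pow (by omega), div_zero]
    · have := (hρ.2 _ h).le
      positivity
  have e1 : ∀ y, (ρ ‖x - y‖ / ‖x - y‖ ^ n) • ballChar 𝕜 n r y = ((h y : ℝ) : 𝕜) := by
    intro y
    rw [hh, ballChar]
    by_cases hy : y ∈ Metric.ball (0 : E n) r
    · simp only [indicator_of_mem hy, norm_smul, norm_one, mul_one, Real.norm_of_nonneg (hk y)]
      rw [RCLike.real_smul_eq_coe_mul, mul_one]
    · simp only [indicator_of_notMem hy, smul_zero, norm_zero, RCLike.ofReal_zero]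
  have e2 : fracInt ρ (ballChar 𝕜 n r) x = ((∫ y, h y : ℝ) : 𝕜) := by
    rw [fracInt, ← integral_ofReal]
    exact integral_congr_ae (Eventually.of_forall e1)
  rw [e2, ← ofReal_norm, RCLike.norm_ofReal,
    abs_of_nonneg (integral_nonneg fun y => norm_nonneg _),
    ofReal_integral_norm_eq_lintegral_enorm hx, ← lintegral_indicator Metric.isOpen_ball.measurableSet]
  refine lintegral_congr fun y => ?_
  rw [enorm_kernel_smul hn hρ, ballChar]
  by_cases hy : y ∈ Metric.ball (0 : E n) r <;> simp [hy]

theorem lintegral_le_luxNorm_id (g : E n → ℝ≥0∞) : ∫⁻ x, g x ≤ luxNorm (fun t => t) g := by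
  rw [← one_mul (luxNorm _ g)]
  refine le_mul_luxNorm one_ne_zero ENNReal.one_ne_top fun l hl0 hlt hl => ?_
  simp only [div_eq_mul_inv] at hl
  rw [lintegral_mul_const' _ _ (ENNReal.inv_ne_top.2 hl0.ne'), ← div_eq_mul_inv,
    ENNReal.div_le_iff_le_mul (Or.inl hl0.ne') (Or.inl hlt.ne)] at hl
  exact hl

theorem ballVol_mul_le_weakMorreyNorm_id {φ : ℝ → ℝ} (hφ : ∀ t, 0 < t → 0 < φ t) {F : E n → 𝕜}
    {s : ℝ} (hs : 0 < s) {v : ℝ≥0∞} (hv : ∀ᵐ x : E n, x ∈ Metric.ball 0 s → v ≤ ‖F x‖ₑ) :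
    v * ballVol n ≤ ENNReal.ofReal (φ s) * weakMorreyNorm (fun t => t) φ F := by
  set W := weakMorreyNorm (fun t => t) φ F
  have hs0 : ENNReal.ofReal (s ^ n) ≠ 0 := (ENNReal.ofReal_pos.2 (by positivity)).ne'
  have hφ0 : ENNReal.ofReal (φ s) ≠ 0 := (ENNReal.ofReal_pos.2 (hφ s hs)).ne'
  have hb0 : (ballVol n : ℝ≥0∞) ≠ 0 := by simpa using ballVol_pos.ne'
  rw [← ENNReal.le_div_iff_mul_le (Or.inl hb0) (Or.inl ENNReal.coe_ne_top)]
  -- The weak norm uses finite levels and strict superlevel sets, so v is approached from below;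
  -- this also allows v = ∞.
  refine ENNReal.le_of_forall_nnreal_lt fun l hl => ?_
  rcases eq_or_ne l 0 with rfl | hl0
  · simp
  rw [ENNReal.le_div_iff_mul_le (Or.inl hb0) (Or.inl ENNReal.coe_ne_top)]
  set B := Metric.ball (0 : E n) s
  have hB : MeasurableSet B := Metric.isOpen_ball.measurableSet
  have h1 : l * volume B ≤ weakOrliczNorm (fun t => t) (B.indicator F) := by
    refine le_trans ?_ (le_iSup₂ (f := fun (l : ℝ≥0) (_ : 0 < l) => luxNorm (fun t => t)
      ({x | (l : ℝ≥0∞) < ‖B.indicator F x‖ₑ}.indicator fun _ => (l : ℝ≥0∞))) l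
        (pos_iff_ne_zero.2 hl0))
    refine le_trans ?_ (lintegral_le_luxNorm_id _)
    rw [← lintegral_indicator_const hB]
    refine lintegral_mono_ae ?_
    filter_upwards [hv] with x hx
    by_cases hxB : x ∈ B
    · have : (l : ℝ≥0∞) < ‖F x‖ₑ := hl.trans_le (hx hxB)
      have hmem : x ∈ {x | (l : ℝ≥0∞) < ‖B.indicator F x‖ₑ} := by
        rwa [mem_ofPred_eq, indicator_of_mem hxB]
      rw [indicator_of_mem hxB, indicator_of_mem hmem]
    · simp [hxB]
  have h2 : (ENNReal.ofReal (φ s))⁻¹ * invPow n (fun t => t) s *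
      weakOrliczNorm (fun t => t) (B.indicator F) ≤ W :=
    le_iSup_of_le 0 (le_iSup₂_of_le s hs le_rfl)
  rw [invPow, youngInv_id, ENNReal.ofReal_inv_of_pos (by positivity)] at h2
  calc (l : ℝ≥0∞) * ballVol n
      = (ENNReal.ofReal (φ s) * (ENNReal.ofReal (φ s))⁻¹) *
        ((ENNReal.ofReal (s ^ n))⁻¹ * ENNReal.ofReal (s ^ n)) * (l * ballVol n) := by
        rw [ENNReal.mul_inv_cancel hφ0 ENNReal.ofReal_ne_top,
          ENNReal.inv_mul_cancel hs0 ENNReal.ofReal_ne_top, one_mul, one_mul]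
    _ = ENNReal.ofReal (φ s) * ((ENNReal.ofReal (φ s))⁻¹ * (ENNReal.ofReal (s ^ n))⁻¹ *
        (l * volume B)) := by rw [volume_ball _ hs]; ring
    _ ≤ ENNReal.ofReal (φ s) * W := by
        gcongr
        refine le_trans ?_ h2
        gcongr

/-- Necessity of the Spanne type condition. -/
theorem BoundedWeak.spanneCond (hn : 1 ≤ n) (hΦ : IsYoung Φ) (hφ₁ : ClassG n Φ φ₁)
    (hφ₂ : ∀ t, 0 < t → 0 < φ₂ t) (hρ : PosMeas ρ)
    (hdec : AlmostDecreasing fun t => ENNReal.ofReal (φ₁ t))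
    (h : BoundedWeak 𝕜 n ρ Φ φ₁ (fun t => t) φ₂) : SpanneCond ρ φ₁ φ₂ := by
  obtain ⟨K, hK⟩ := exists_morreyNorm_ballChar_le (𝕜 := 𝕜) hΦ hφ₁ hdec
  obtain ⟨C, h⟩ := h
  obtain ⟨A, -, hA⟩ := hφ₁.isDoubling hΦ 2 2 two_pos two_pos
  have hc : 0 < n * ballVol n * ballVol n :=
    mul_pos (mul_pos (by exact_mod_cast hn) ballVol_pos) ballVol_pos
  refine ⟨(n * ballVol n * ballVol n)⁻¹ * (A * (C * K)), fun s hs => ?_⟩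
  have h2s : 0 < 2 * s := by positivity
  set I := ∫⁻ t in Ioo 0 s, ENNReal.ofReal (ρ t / t)
  -- Radius 2s guarantees B(x,s) ⊆ B(0,2s) for every x in B(0,s), so I_ρ f is bounded below on all
  -- of B(0,s). Doubling of φ₁ removes the 2 at the end.
  set f := ballChar 𝕜 n (2 * s)
  have hp0 : ENNReal.ofReal (φ₁ (2 * s)) ≠ 0 := (hφ₁.pos h2s).ne'
  have hf : MemMorrey Φ φ₁ f :=
    memMorrey_of_morreyNorm hΦ hφ₁.1.2 (stronglyMeasurable_ballChar _).aestronglyMeasurable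
      ((hK _ h2s).trans_lt (ENNReal.mul_lt_top ENNReal.coe_lt_top
        (ENNReal.inv_lt_top.2 (pos_iff_ne_zero.2 hp0))))
  obtain ⟨hdef, -, hle⟩ := h f hf
  have hlow : ∀ᵐ x : E n, x ∈ Metric.ball 0 s →
      (n * ballVol n : ℝ≥0) * I ≤ ‖fracInt ρ f x‖ₑ := by
    filter_upwards [hdef] with x hx hxs
    rw [enorm_fracInt_ballChar hn hρ _ hx, ← setLIntegral_ball_kernel hn hρ.1 x s]
    refine lintegral_mono_set (Metric.ball_subset_ball' ?_)
    have := Metric.mem_ball.1 hxs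
    linarith
  have h1 := ballVol_mul_le_weakMorreyNorm_id hφ₂ hs hlow
  have h2 : (n * ballVol n * ballVol n : ℝ≥0) * I ≤
      ENNReal.ofReal (φ₂ s) * (C * (K * (ENNReal.ofReal (φ₁ (2 * s)))⁻¹)) := by
    calc ((n * ballVol n * ballVol n : ℝ≥0) : ℝ≥0∞) * I
        = (n * ballVol n : ℝ≥0) * I * ballVol n := by push_cast; ring
      _ ≤ _ := h1
      _ ≤ _ := mul_le_mul_right (hle.trans (mul_le_mul_right (hK _ h2s) _)) _
  calc ENNReal.ofReal (φ₁ s) * I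
      ≤ A * ENNReal.ofReal (φ₁ (2 * s)) * I := by
        gcongr
        exact hA s (2 * s) hs h2s le_rfl le_rfl
    _ = A * ENNReal.ofReal (φ₁ (2 * s)) * ((n * ballVol n * ballVol n)⁻¹ : ℝ≥0) *
        ((n * ballVol n * ballVol n : ℝ≥0) * I) := by
        rw [mul_assoc _ (((n * ballVol n * ballVol n)⁻¹ : ℝ≥0) : ℝ≥0∞), ← mul_assoc _ _ I,
          ← ENNReal.coe_mul, inv_mul_cancel₀ hc.ne', ENNReal.coe_one, one_mul]
    _ ≤ A * ENNReal.ofReal (φ₁ (2 * s)) * ((n * ballVol n * ballVol n)⁻¹ : ℝ≥0) *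
        (ENNReal.ofReal (φ₂ s) * (C * (K * (ENNReal.ofReal (φ₁ (2 * s)))⁻¹))) :=
        mul_le_mul_right h2 _
    _ = ((n * ballVol n * ballVol n)⁻¹ : ℝ≥0) * (A * (C * K)) * ENNReal.ofReal (φ₂ s) *
        ((ENNReal.ofReal (φ₁ (2 * s)))⁻¹ * ENNReal.ofReal (φ₁ (2 * s))) := by ring
    _ = _ := by
        rw [ENNReal.inv_mul_cancel hp0 ENNReal.ofReal_ne_top, mul_one, ENNReal.coe_mul _ (A * _),
          ENNReal.coe_mul A, ENNReal.coe_mul C]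

/-- The tail is ≲ φ₁(r)ρ(r), and ρ(r) ≲ ∫₀^{qr} ρ dt/t with q = k·2ᴺ. Doubling moves φ₁ from r to
qr, the hypothesis applies there, and doubling of φ₂ returns to r. -/
theorem SpanneCond.tailCond (hΦ : IsYoung Φ) (hΨ : IsYoung Ψ) (hφ₁ : ClassG n Φ φ₁)
    (hφ₂ : ClassG n Ψ φ₂) (hsup : SupCond ρ) (htail : TailCond ρ φ₁ fun r => φ₁ r * ρ r)
    (h : SpanneCond ρ φ₁ φ₂) : TailCond ρ φ₁ φ₂ := by
  obtain ⟨C, k, N, hk, hρ⟩ := hsup.exists_supBound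
  obtain ⟨C₁, htail⟩ := htail
  obtain ⟨C₂, h⟩ := h
  set q := k * 2 ^ N with hq
  have hq0 : 0 < q := by positivity
  obtain ⟨A₁, -, hA₁⟩ := hφ₁.isDoubling hΦ q q hq0 hq0
  obtain ⟨A₂, -, hA₂⟩ := hφ₂.isDoubling hΨ q⁻¹ q⁻¹ (by positivity) (by positivity)
  refine ⟨C₁ * (C * (A₁ * (C₂ * A₂))), fun r hr => (htail r hr).trans ?_⟩
  have hqr : 0 < q * r := by positivity
  have h1 : ENNReal.ofReal (ρ r) ≤ C * ∫⁻ t in Ioo 0 (q * r), ENNReal.ofReal (ρ t / t) := by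
    refine le_trans (le_iSup₂ (f := fun t (_ : t ∈ Icc (r / 2) r) => ENNReal.ofReal (ρ t)) r
      ⟨by linarith, le_rfl⟩) ((hρ r hr).trans ?_)
    refine mul_le_mul_right (lintegral_mono_set (Ioo_subset_Ioo (by positivity) (le_of_eq ?_))) _
    rw [hq]
    ring
  set I := ∫⁻ t in Ioo 0 (q * r), ENNReal.ofReal (ρ t / t)
  calc (C₁ : ℝ≥0∞) * ENNReal.ofReal (φ₁ r * ρ r)
      = C₁ * (ENNReal.ofReal (φ₁ r) * ENNReal.ofReal (ρ r)) := by
        rw [ENNReal.ofReal_mul (hφ₁.1.2 r hr).le]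
    _ ≤ C₁ * ((A₁ * ENNReal.ofReal (φ₁ (q * r))) * (C * I)) := by
        gcongr
        exact hA₁ r _ hr hqr le_rfl le_rfl
    _ = C₁ * (C * (A₁ * (ENNReal.ofReal (φ₁ (q * r)) * I))) := by ring
    _ ≤ C₁ * (C * (A₁ * (C₂ * ENNReal.ofReal (φ₂ (q * r))))) :=
        mul_le_mul_right (mul_le_mul_right (mul_le_mul_right (h _ hqr) _) _) _
    _ ≤ C₁ * (C * (A₁ * (C₂ * (A₂ * ENNReal.ofReal (φ₂ r))))) := by
        refine mul_le_mul_right (mul_le_mul_right (mul_le_mul_right (mul_le_mul_right ?_ _) _) _) _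
        exact hA₂ _ r hqr hr (inv_mul_cancel_left₀ hq0.ne' _).le
          (inv_mul_cancel_left₀ hq0.ne' _).ge
    _ = _ := by push_cast; ring

end Necessity

end OrliczMorrey

theorem mainTheorem3 (𝕜 : Type*) [RCLike 𝕜] (n : ℕ) (hn : 1 ≤ n)
    (Φ Ψ : ℝ≥0∞ → ℝ≥0∞) (hΦ : IsYoung Φ) (hΨ : IsYoung Ψ)
    (φ₁ φ₂ : ℝ → ℝ) (hφ₁ : ClassG n Φ φ₁) (hφ₂ : ClassG n Ψ φ₂)
    (ρ : ℝ → ℝ) (hρ : PosMeas ρ) :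
    -- first part: sufficiency
    (IntCond ρ → SupCond ρ → OrliczCond n ρ Φ Ψ → RatioCond n Φ Ψ φ₁ φ₂ → TailCond ρ φ₁ φ₂ →
      BoundedWeak 𝕜 n ρ Φ φ₁ Ψ φ₂ ∧ BoundedWeak 𝕜 n ρ Φ φ₁ (fun t => t) φ₂ ∧
        (Nabla2 Φ → BoundedStrong 𝕜 n ρ Φ φ₁ Ψ φ₂)) ∧
    -- second part: necessity
    (AlmostDecreasing (fun t => ENNReal.ofReal (φ₁ t)) →
      (BoundedWeak 𝕜 n ρ Φ φ₁ (fun t => t) φ₂ → SpanneCond ρ φ₁ φ₂) ∧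
      (BoundedWeak 𝕜 n ρ Φ φ₁ Ψ φ₂ → SpanneCond ρ φ₁ φ₂) ∧
      (BoundedStrong 𝕜 n ρ Φ φ₁ Ψ φ₂ → SpanneCond ρ φ₁ φ₂)) ∧
    -- third part: characterization
    (IntCond ρ → SupCond ρ → OrliczCond n ρ Φ Ψ →
      AlmostDecreasing (fun t => ENNReal.ofReal (φ₁ t)) → RatioCond n Φ Ψ φ₁ φ₂ →
      TailCond ρ φ₁ (fun r => φ₁ r * ρ r) →
      (SpanneCond ρ φ₁ φ₂ ↔ BoundedWeak 𝕜 n ρ Φ φ₁ Ψ φ₂) ∧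
        (Nabla2 Φ → (SpanneCond ρ φ₁ φ₂ ↔ BoundedStrong 𝕜 n ρ Φ φ₁ Ψ φ₂))) := by
  have suff := fun (hsup : SupCond ρ) (hcond : OrliczCond n ρ Φ Ψ)
    (hratio : RatioCond n Φ Ψ φ₁ φ₂) (htail : TailCond ρ φ₁ φ₂) =>
    boundedWeak_of_conditions (𝕜 := 𝕜) hn hΦ hΨ hφ₁ hφ₂ hρ hsup hcond hratio htail
  have suffs := fun (hsup : SupCond ρ) (hcond : OrliczCond n ρ Φ Ψ)
    (hratio : RatioCond n Φ Ψ φ₁ φ₂) (htail : TailCond ρ φ₁ φ₂) =>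
    boundedStrong_of_conditions (𝕜 := 𝕜) hn hΦ hΨ hφ₁ hφ₂ hρ hsup hcond hratio htail
  have nec := fun (hdec : AlmostDecreasing fun t => ENNReal.ofReal (φ₁ t))
    (h : BoundedWeak 𝕜 n ρ Φ φ₁ (fun t => t) φ₂) => h.spanneCond hn hΦ hφ₁ hφ₂.1.2 hρ hdec
  refine ⟨fun _ hsup hcond hratio htail => ?_, fun hdec => ?_,
    fun _ hsup hcond hdec hratio htail => ?_⟩
  · have hw := suff hsup hcond hratio htail
    exact ⟨hw, hw.boundedWeak_id hΨ, suffs hsup hcond hratio htail⟩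
  · exact ⟨nec hdec, fun h => nec hdec (h.boundedWeak_id hΨ),
      fun h => nec hdec ((h.boundedWeak hΨ).boundedWeak_id hΨ)⟩
  · have htail' := fun h : SpanneCond ρ φ₁ φ₂ => h.tailCond hΦ hΨ hφ₁ hφ₂ hsup htail
    exact ⟨⟨fun h => suff hsup hcond hratio (htail' h), fun h => nec hdec (h.boundedWeak_id hΨ)⟩,
      fun h2 => ⟨fun h => suffs hsup hcond hratio (htail' h) h2,
        fun h => nec hdec ((h.boundedWeak hΨ).boundedWeak_id hΨ)⟩⟩
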